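/- Let $\mathbb{K}$ be a field of characteristic $0$, let $n\ge 3$, and let $q_{ij}\in\mathbb{K}^*$ ($1\le i,j\le n$) satisfy $q_{ii}=1$ and $q_{ij}q_{ji}=1$, with the elements $q_{ij}$ ($i<j$) algebraically independent over $\mathbb{Q}$. Let $$R=\mathbb{K}\langle x_1,\dots,x_n\rangle/(x_ix_j-q_{ij}x_jx_i : 1\le i,j\le n),$$ graded by $\mathbb{Z}^n$ with $\deg x_i=e_i$, the $i$-th standard basis vector, and let $\beta:\mathbb{Z}^n\times\mathbb{Z}^n\to\mathbb{K}^*$ be the bicharacter with $\beta(e_i,e_j)=q_{ij}$. For $a\in\mathbb{Z}^n$ let $\sigma_a$ be the automorphism of $R$ that multiplies elements of degree $d$ by $\beta(a,d)$. For $r\in R$ let $\lambda_r,\rho_r\in\operatorname{End}_{\mathbb{K}}(R)$ be left and right multiplication by $r$, and let $\delta_i\in \operatorname{End}_{\mathbb{K}}(R)$ be the unique linear map with $\delta_i(rs)=\delta_i(r)\sigma_{e_i}(s)+r\delta_i(s)$ for all $r,s\in R$, $\delta_i(x_i)=1$ and $\delta_i(x_j)=0$ for $j\ne i$. Let $D_q(R)=\bigcup_{m\ge0}D_q^m(R)$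 be the algebra of quantum differential operators on $R$, where $D_q^{-1}(R)=0$ and, for $m\ge 0$, $D_q^m(R)$ is the span of all $\lambda_s\varphi\lambda_t$ with $s,t\in R$ and $\varphi\in\operatorname{End}_{\mathbb{K}}(R)$ homogeneous (for the $\mathbb{Z}^n$-grading) such that, for some $a\in\mathbb{Z}^n$, $\varphi\lambda_r-\lambda_{\sigma_a(r)}\varphi\in D_q^{m-1}(R)$ for all $r\in R$. Let $\Delta$ be the $\mathbb{K}$-algebra of operators on $R$ generated by $\rho_{x_1},\dots,\rho_{x_n},\delta_1,\dots,\delta_n$. Then $\Delta\subseteq D_q(R)$, and: 1. $\Delta$ is a simple, left and right Noetherian domain of Gelfand–Kirillov dimension $2n$. 2. The elements $\rho_{x_1}^{i_1}\cdots\rho_{x_n}^{i_n}\delta_1^{j_1}\cdots\delta_n^{j_n}$, with $i_k,j_k\ge0$, form a $\mathbb{K}$-basis of $\Delta$. 3. Put $\lambda_{ij}=q_{ji}$ and $\Lambda=(\lambda_{ij})$, and let $A_n^{\Lambda}$ be the higher quantized Weyl algebra, that is, the $\mathbb{K}$-algebra generated by $u_1,\dots,u_n,v_1,\dots,v_n$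 subject to the relations $v_jv_i=\lambda_{ji}v_iv_j$ and $u_ju_i=\lambda_{ji}u_iu_j$ for all $i,j$, $u_jv_i=\lambda_{ij}v_iu_j$ for $i\ne j$, and $u_iv_i-v_iu_i=1$ for all $i$. Then there is an isomorphism of $\mathbb{K}$-algebras $\theta:A_n^{\Lambda}\to\Delta$ with $\theta(u_i)=\delta_i$ and $\theta(v_i)=\rho_{x_i}$ for all $i$. -/

import Mathlib

open Filter

/-- A multiplicatively antisymmetric `n × n` matrix of nonzero scalars:
`q i i = 1` and `q i j * q j i = 1`. -/
structure QuantumMatrix (K : Type*) [Field K] (n : ℕ) where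
  entry : Fin n → Fin n → Kˣ
  diag : ∀ i, entry i i = 1
  antisymm : ∀ i j, entry i j * entry j i = 1

/-- The transposed matrix. -/
def QuantumMatrix.transpose {K : Type*} [Field K] {n : ℕ} (Q : QuantumMatrix K n) :
    QuantumMatrix K n where
  entry i j := Q.entry j i
  diag := Q.diag
  antisymm i j := Q.antisymm j i

/-! ### Quantum differential operators on a graded algebra -/

section QuantumDiffOp

variable {K R Γ : Type*} [Field K] [Ring R] [Algebra K R] [AddCommGroup Γ] [DecidableEq Γ]

/-- `φ` is homogeneous of degree `e`: it maps `R_d` into `R_{e + d}` for all `d`. -/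
def IsHomogeneousOfDegree (𝒜 : Γ → Submodule K R) (φ : Module.End K R) (e : Γ) : Prop :=
  ∀ d, ∀ r ∈ 𝒜 d, φ r ∈ 𝒜 (e + d)

/-- The `R`-bimodule generated by all homogeneous `φ` such that, for some `a : Γ`, every twisted
commutator `[φ, r]_a = φ r - σ_a(r) φ` lies in `N`. Here `(φ r)(s) = φ (r s)`,
`(r φ)(s) = r φ(s)`, and `σ_a r = β(a, d) r` for `r` homogeneous of degree `d`; since `N` is a
subspace and `R` is spanned by homogeneous elements, it is enough to let `r` run over those. -/
def quantumStep (β : Γ → Γ → Kˣ) (𝒜 : Γ → Submodule K R) (N : Submodule K (Module.End K R)) :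
    Submodule K (Module.End K R) :=
  Submodule.span K
    {ψ | ∃ (s t : R) (φ : Module.End K R), (∃ e, IsHomogeneousOfDegree 𝒜 φ e) ∧
      (∃ a : Γ, ∀ d, ∀ r ∈ 𝒜 d,
        φ * LinearMap.mulLeft K r - (β a d : K) • (LinearMap.mulLeft K r * φ) ∈ N) ∧
      ψ = LinearMap.mulLeft K s * φ * LinearMap.mulLeft K t}

/-- Quantum differential operators of order at most `m`. -/
def quantumDiffOpOfOrder (β : Γ → Γ → Kˣ) (𝒜 : Γ → Submodule K R) :
    ℕ → Submodule K (Module.End K R)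
  | 0 => quantumStep β 𝒜 ⊥
  | m + 1 => quantumStep β 𝒜 (quantumDiffOpOfOrder β 𝒜 m)

/-- `D_q(R)`, the space of all quantum differential operators on the `Γ`-graded algebra `R` with
respect to the bicharacter `β` (the union of an increasing chain). -/
def quantumDiffOp (β : Γ → Γ → Kˣ) (𝒜 : Γ → Submodule K R) [GradedAlgebra 𝒜] :
    Submodule K (Module.End K R) :=
  ⨆ m, quantumDiffOpOfOrder β 𝒜 m

end QuantumDiffOp

/-! ### The coordinate algebra of quantum affine `n`-space -/

/-- The relations `x_i x_j = q_ij x_j x_i`. -/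
inductive QuantumSpaceRel {K : Type*} [Field K] {n : ℕ} (Q : QuantumMatrix K n) :
    FreeAlgebra K (Fin n) → FreeAlgebra K (Fin n) → Prop
  | comm (i j : Fin n) : QuantumSpaceRel Q
      (FreeAlgebra.ι K i * FreeAlgebra.ι K j)
      ((Q.entry i j : K) • (FreeAlgebra.ι K j * FreeAlgebra.ι K i))

/-- `R_n = K⟨x_1, …, x_n⟩ / (x_i x_j - q_ij x_j x_i)`. -/
def QuantumSpace {K : Type*} [Field K] {n : ℕ} (Q : QuantumMatrix K n) : Type _ :=
  RingQuot (QuantumSpaceRel Q)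

namespace QuantumSpace

variable {K : Type*} [Field K] {n : ℕ} (Q : QuantumMatrix K n)

instance : Ring (QuantumSpace Q) := inferInstanceAs (Ring (RingQuot (QuantumSpaceRel Q)))

instance : Algebra K (QuantumSpace Q) :=
  inferInstanceAs (Algebra K (RingQuot (QuantumSpaceRel Q)))

/-- The quotient map from the free algebra. -/
def mk : FreeAlgebra K (Fin n) →ₐ[K] QuantumSpace Q := RingQuot.mkAlgHom K (QuantumSpaceRel Q)

/-- The generator `x_i` of `R_n`. -/
def x (i : Fin n) : QuantumSpace Q := mk Q (FreeAlgebra.ι K i)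

theorem mk_surjective : Function.Surjective (mk Q) :=
  RingQuot.mkAlgHom_surjective K (QuantumSpaceRel Q)

theorem x_mul_x (i j : Fin n) : x Q i * x Q j = (Q.entry i j : K) • (x Q j * x Q i) := by
  have h : mk Q (FreeAlgebra.ι K i * FreeAlgebra.ι K j) =
      mk Q ((Q.entry i j : K) • (FreeAlgebra.ι K j * FreeAlgebra.ι K i)) :=
    RingQuot.mkAlgHom_rel K (QuantumSpaceRel.comm (Q := Q) i j)
  rw [map_mul, map_smul, map_mul] at h
  exact h

/-- Algebra maps out of `R_n`: families `f` with `f i * f j = q_ij • (f j * f i)`. -/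
def lift {A : Type*} [Ring A] [Algebra K A] (f : Fin n → A)
    (hf : ∀ i j, f i * f j = (Q.entry i j : K) • (f j * f i)) : QuantumSpace Q →ₐ[K] A :=
  RingQuot.liftAlgHom K ⟨FreeAlgebra.lift K f, by
    rintro _ _ ⟨i, j⟩
    simp [hf i j]⟩

@[simp] theorem lift_x {A : Type*} [Ring A] [Algebra K A] (f : Fin n → A)
    (hf : ∀ i j, f i * f j = (Q.entry i j : K) • (f j * f i)) (i : Fin n) :
    lift Q f hf (x Q i) = f i := by
  have h : lift Q f hf (x Q i) = FreeAlgebra.lift K f (FreeAlgebra.ι K i) :=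
    RingQuot.liftAlgHom_mkAlgHom_apply K _ _ _
  rw [h, FreeAlgebra.lift_ι_apply]

variable {Q} in
theorem hom_ext {A : Type*} [Ring A] [Algebra K A] {f g : QuantumSpace Q →ₐ[K] A}
    (h : ∀ i, f (x Q i) = g (x Q i)) : f = g := by
  have hfg : f.comp (mk Q) = g.comp (mk Q) := by
    apply FreeAlgebra.hom_ext
    funext i
    exact h i
  ext r
  obtain ⟨r, rfl⟩ := mk_surjective Q r
  exact DFunLike.congr_fun hfg r

/-- The natural bicharacter `β` on `ℤⁿ`, with `β(e_i, e_j) = q_ij`. -/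
def bichar (a b : Fin n → ℤ) : Kˣ := ∏ i, ∏ j, Q.entry i j ^ (a i * b j)

/-- The degree in `ℤⁿ` of the word `x_{i_1} ⋯ x_{i_k}`, where `deg x_i = e_i`. -/
def wordDegree (w : List (Fin n)) : Fin n → ℤ := (w.map fun i => Pi.single i 1).sum

/-- The `ℤⁿ`-grading of `R_n` with `deg x_i = e_i`. -/
def grading (d : Fin n → ℤ) : Submodule K (QuantumSpace Q) :=
  Submodule.span K {r | ∃ w : List (Fin n), wordDegree w = d ∧ r = (w.map (x Q)).prod}

instance : SetLike.GradedMonoid (grading Q) where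
  one_mem := Submodule.subset_span ⟨[], by simp [wordDegree], by simp⟩
  mul_mem := by
    intro d e r s hr hs
    have h := Submodule.mul_mem_mul hr hs
    rw [grading, grading, Submodule.span_mul_span] at h
    refine Submodule.span_mono ?_ h
    rintro _ ⟨_, ⟨w, rfl, rfl⟩, _, ⟨w', rfl, rfl⟩, rfl⟩
    exact ⟨w ++ w', by simp [wordDegree], by simp⟩

theorem x_mem_grading (i : Fin n) : x Q i ∈ grading Q (Pi.single i 1) :=
  Submodule.subset_span ⟨[i], by simp [wordDegree], by simp⟩

theorem of_congr {d e : Fin n → ℤ} (h : d = e) (r : grading Q d) (s : grading Q e)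
    (hrs : (r : QuantumSpace Q) = s) :
    DirectSum.of (fun i => grading Q i) d r = DirectSum.of (fun i => grading Q i) e s := by
  subst h
  rw [Subtype.ext hrs]

/-- The decomposition of an element of `R_n` into homogeneous components. -/
def decompose : QuantumSpace Q →ₐ[K] DirectSum (Fin n → ℤ) fun d => grading Q d :=
  lift Q (fun i => DirectSum.of (fun d => grading Q d) (Pi.single i 1) ⟨x Q i, x_mem_grading Q i⟩)
    (by
      intro i j
      rw [DirectSum.of_mul_of, DirectSum.of_mul_of, ← DirectSum.lof_eq_of K, ← DirectSum.lof_eq_of K,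
        ← map_smul, DirectSum.lof_eq_of, DirectSum.lof_eq_of]
      exact of_congr Q (add_comm _ _) _ _ (x_mul_x Q i j))

instance : GradedAlgebra (grading Q) :=
  GradedAlgebra.ofAlgHom (grading Q) (decompose Q)
    (by
      apply hom_ext
      intro i
      simp [decompose])
    (by
      rintro d ⟨r, hr⟩
      induction hr using Submodule.span_induction with
      | mem r h =>
        obtain ⟨w, rfl, rfl⟩ := h
        induction w with
        | nil =>
          simp only [List.map_nil, List.prod_nil, map_one]
          exact of_congr Q (by simp [wordDegree]) _ _ rfl
        | cons i w ih =>
          simp only [List.map_cons, List.prod_cons, map_mul]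
          rw [ih, decompose, lift_x, DirectSum.of_mul_of]
          exact of_congr Q (by simp [wordDegree]) _ _ rfl
      | zero => rw [map_zero]; exact (map_zero _).symm
      | add r s hr hs ihr ihs =>
        rw [map_add, ihr, ihs, ← map_add]
        rfl
      | smul c r hr ihr =>
        rw [map_smul, ihr, ← DirectSum.lof_eq_of K, ← map_smul]
        rfl)

/-- The automorphism `σ_a` of `R_n`: multiplication by `β(a, d)` in degree `d`, that is,
`x_j ↦ β(a, e_j) x_j`. -/
def sigma (a : Fin n → ℤ) : QuantumSpace Q →ₐ[K] QuantumSpace Q :=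
  lift Q (fun j => (bichar Q a (Pi.single j 1) : K) • x Q j) (by
    intro i j
    simp only [smul_mul_smul_comm, smul_smul, x_mul_x Q i j]
    congr 1
    ring)

theorem bichar_single (i j : Fin n) :
    bichar Q (Pi.single i 1) (Pi.single j 1) = Q.entry i j := by
  rw [bichar, Finset.prod_eq_single i, Finset.prod_eq_single j]
  · simp
  · intro b _ hb
    simp [Pi.single_eq_of_ne hb]
  · simp
  · intro b _ hb
    simp [Pi.single_eq_of_ne hb]
  · simp

/-- The algebra map `r ↦ [[r, δ_i r], [0, σ_{e_i} r]]`, determined by its values on the `x_j`. Its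
multiplicativity says that `σ_{e_i}` is an algebra map and `δ_i` a right `σ_{e_i}`-derivation. -/
def deltaMatrix (i : Fin n) : QuantumSpace Q →ₐ[K] Matrix (Fin 2) (Fin 2) (QuantumSpace Q) :=
  lift Q (fun j => !![x Q j, if j = i then 1 else 0; 0, (Q.entry i j : K) • x Q j]) (by
    intro j k
    have hjk := x_mul_x Q j k
    have hinv : ∀ a b : Fin n, (Q.entry a b : K) * (Q.entry b a : K) = 1 := fun a b => by
      rw [← Units.val_mul, Q.antisymm, Units.val_one]
    ext a b
    simp only [Matrix.smul_apply, Matrix.mul_apply, Fin.sum_univ_two]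
    fin_cases a <;> fin_cases b
    · simp [hjk]
    · by_cases hj : j = i <;> by_cases hk : k = i
      · subst hj; subst hk; simp [Q.diag]
      · subst hj; simp [hk]
      · subst hk; simp [hj, smul_smul, hinv]
      · simp [hj, hk]
    · simp
    · simp [hjk, smul_smul]
      congr 1
      ring)

/-- The right `σ_{e_i}`-derivation `δ_i` of `R_n` with `δ_i(x_i) = 1` and `δ_i(x_j) = 0` for
`j ≠ i`. -/
def delta (i : Fin n) : Module.End K (QuantumSpace Q) where
  toFun r := deltaMatrix Q i r 0 1
  map_add' r s := by simp
  map_smul' c r := by simp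

theorem delta_x (i j : Fin n) : delta Q i (x Q j) = if j = i then 1 else 0 := by
  simp [delta, deltaMatrix]

theorem deltaMatrix_apply (i : Fin n) (r : QuantumSpace Q) :
    deltaMatrix Q i r 0 0 = r ∧ deltaMatrix Q i r 1 0 = 0 ∧
      deltaMatrix Q i r 1 1 = sigma Q (Pi.single i 1) r := by
  obtain ⟨r, rfl⟩ := mk_surjective Q r
  induction r using FreeAlgebra.induction with
  | grade0 c => simp [Matrix.algebraMap_matrix_apply]
  | grade1 j =>
    have h : mk Q (FreeAlgebra.ι K j) = x Q j := rfl
    rw [h]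
    simp [deltaMatrix, sigma, bichar_single]
  | mul r s hr hs => simp [Matrix.mul_apply, Fin.sum_univ_two, hr, hs]
  | add r s hr hs => simp [hr, hs]

/-- `δ_i` is a right `σ_{e_i}`-derivation. -/
theorem delta_mul (i : Fin n) (r s : QuantumSpace Q) :
    delta Q i (r * s) = delta Q i r * sigma Q (Pi.single i 1) s + r * delta Q i s := by
  change deltaMatrix Q i (r * s) 0 1 = _
  rw [map_mul, Matrix.mul_apply, Fin.sum_univ_two, (deltaMatrix_apply Q i r).1,
    (deltaMatrix_apply Q i s).2.2, add_comm]
  rfl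

/-- Right multiplication `ρ_{x_i}`. -/
def rho (i : Fin n) : Module.End K (QuantumSpace Q) := LinearMap.mulRight K (x Q i)

/-- `Δ`, the algebra of operators on `R_n` generated by the `ρ_{x_i}` and the `δ_i`. -/
def Delta : Subalgebra K (Module.End K (QuantumSpace Q)) :=
  Algebra.adjoin K (Set.range (rho Q) ∪ Set.range (delta Q))

/-- `ρ_I = ρ_{x_1}^{i_1} ⋯ ρ_{x_n}^{i_n}`. -/
def rhoMonomial (I : Fin n → ℕ) : Module.End K (QuantumSpace Q) :=
  (List.ofFn fun k => rho Q k ^ I k).prod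

/-- `δ_J = δ_1^{j_1} ⋯ δ_n^{j_n}`. -/
def deltaMonomial (J : Fin n → ℕ) : Module.End K (QuantumSpace Q) :=
  (List.ofFn fun k => delta Q k ^ J k).prod

end QuantumSpace

/-! ### Higher quantized Weyl algebras -/

/-- The defining relations of `A_n^Λ`; `Sum.inl i` stands for `u_i` and `Sum.inr i` for `v_i`. -/
inductive QuantizedWeylRel {K : Type*} [Field K] {n : ℕ} (L : QuantumMatrix K n) :
    FreeAlgebra K (Fin n ⊕ Fin n) → FreeAlgebra K (Fin n ⊕ Fin n) → Prop
  | vv (i j : Fin n) : QuantizedWeylRel L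
      (FreeAlgebra.ι K (Sum.inr j) * FreeAlgebra.ι K (Sum.inr i))
      ((L.entry j i : K) • (FreeAlgebra.ι K (Sum.inr i) * FreeAlgebra.ι K (Sum.inr j)))
  | uu (i j : Fin n) : QuantizedWeylRel L
      (FreeAlgebra.ι K (Sum.inl j) * FreeAlgebra.ι K (Sum.inl i))
      ((L.entry j i : K) • (FreeAlgebra.ι K (Sum.inl i) * FreeAlgebra.ι K (Sum.inl j)))
  | uv (i j : Fin n) (hij : i ≠ j) : QuantizedWeylRel L
      (FreeAlgebra.ι K (Sum.inl j) * FreeAlgebra.ι K (Sum.inr i))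
      ((L.entry i j : K) • (FreeAlgebra.ι K (Sum.inr i) * FreeAlgebra.ι K (Sum.inl j)))
  | weyl (i : Fin n) : QuantizedWeylRel L
      (FreeAlgebra.ι K (Sum.inl i) * FreeAlgebra.ι K (Sum.inr i) -
        FreeAlgebra.ι K (Sum.inr i) * FreeAlgebra.ι K (Sum.inl i))
      1

/-- The higher quantized Weyl algebra `A_n^Λ`. -/
def QuantizedWeyl {K : Type*} [Field K] {n : ℕ} (L : QuantumMatrix K n) : Type _ :=
  RingQuot (QuantizedWeylRel L)

namespace QuantizedWeyl

variable {K : Type*} [Field K] {n : ℕ} (L : QuantumMatrix K n)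

instance : Ring (QuantizedWeyl L) := inferInstanceAs (Ring (RingQuot (QuantizedWeylRel L)))

instance : Algebra K (QuantizedWeyl L) :=
  inferInstanceAs (Algebra K (RingQuot (QuantizedWeylRel L)))

/-- The quotient map from the free algebra. -/
def mk : FreeAlgebra K (Fin n ⊕ Fin n) →ₐ[K] QuantizedWeyl L :=
  RingQuot.mkAlgHom K (QuantizedWeylRel L)

/-- The generator `u_i` of `A_n^Λ`. -/
def u (i : Fin n) : QuantizedWeyl L := mk L (FreeAlgebra.ι K (Sum.inl i))

/-- The generator `v_i` of `A_n^Λ`. -/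
def v (i : Fin n) : QuantizedWeyl L := mk L (FreeAlgebra.ι K (Sum.inr i))

end QuantizedWeyl

/-! ### Gelfand–Kirillov dimension -/

/-- The Gelfand–Kirillov dimension of a `K`-algebra `A`: the supremum, over the finite-dimensional
subspaces `V` of `A` that contain `1`, of `limsup_m log (dim V ^ m) / log m`. -/
noncomputable def gkDim (K A : Type*) [Field K] [Ring A] [Algebra K A] : EReal :=
  ⨆ (V : Submodule K A) (_ : FiniteDimensional K V) (_ : (1 : A) ∈ V),
    limsup (fun m : ℕ =>
      ((Real.log (Module.finrank K ↥(V ^ m) : ℝ) / Real.log (m : ℝ) : ℝ) : EReal)) atTop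

/-! Everything rests on a normal form. The twisted Leibniz rule, applied to products with last
factor `x_j`, gives the relations between `δ_i` and `ρ_{x_j}`; associativity gives those among the
`ρ`; those among the `δ` hold because their defect skew-commutes with every `ρ` and kills `1`. Such
relations sort any word into monomials `ρ_I δ_J`, so the sorted monomials span both `Δ` and the
abstract algebra `A_n^Λ`. In `Δ` they are independent, since `δ_J` acts triangularly on monomials of
`R`: it kills the one of exponent `I` unless `J ≤ I`, and otherwise lowers the exponent by `J` with
a factor that is nonzero in characteristic `0`. A surjection carrying a spanning family to a basis
is an isomorphism (`lift_bijective`).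

A product of two monomials is a nonzero multiple of the monomial with the summed exponent, plus
componentwise smaller ones (`hasWeylLead_mul`). Read in the lexicographic order, this makes leading
terms multiplicative: there are no zero divisors, and Dickson's lemma yields the Noetherian property
on both sides. It also traps the powers of finite-dimensional subspaces in boxes of exponents, whose
dimension grows with exponent `2n`.

For simplicity, commutation with `v_i u_i` is diagonal on monomials with integer weights. On
elements homogeneous for all these weights, skew-commutators with `u_i` and `v_i` act like partial
derivatives. Both operations shrink an element of an ideal until a nonzero scalar is left
(`one_mem_of_mem`).

Finally, right multiplication by `ρ_{x_i}` preserves the order of a quantum differential operator,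
and right multiplication by `δ_i` raises it by at most one, because `δ_i` commutes with left
multiplications up to left multiplications times `σ_{e_i}`. -/

/-! ### Algebras with a basis that is multiplicative up to lower terms -/

section LeadingTerm

variable {K A ι : Type*} [Field K] [Ring A] [Algebra K A] [LinearOrder ι]

/-- `a` is a nonzero multiple of `b p` plus a combination of the `b r` with `r < p`. -/
def HasLead (b : Module.Basis ι K A) (a : A) (p : ι) : Prop :=
  ∃ c : K, c ≠ 0 ∧ a - c • b p ∈ Submodule.span K (b '' Set.Iio p)

theorem hasLead_basis (b : Module.Basis ι K A) (p : ι) : HasLead b (b p) p :=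
  ⟨1, one_ne_zero, by simp⟩

theorem HasLead.ne_zero {b : Module.Basis ι K A} {a : A} {p : ι} (h : HasLead b a p) : a ≠ 0 := by
  rintro rfl
  obtain ⟨c, hc, h⟩ := h
  rw [zero_sub, neg_mem_iff, Submodule.smul_mem_iff _ hc] at h
  exact b.linearIndependent.notMem_span_image (s := Set.Iio p) (by simp) h

theorem HasLead.mem_span {b : Module.Basis ι K A} {a : A} {p : ι} (h : HasLead b a p) :
    a ∈ Submodule.span K (b '' Set.Iic p) := by
  obtain ⟨c, -, h⟩ := h
  rw [← sub_add_cancel a (c • b p)]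
  exact add_mem (Submodule.span_mono (Set.image_mono Set.Iio_subset_Iic_self) h)
    (Submodule.smul_mem _ _ (Submodule.subset_span ⟨p, Set.mem_Iic.2 le_rfl, rfl⟩))

/-- The leading exponent is the maximum of the support. Locating it in `S` is what shows later that
a lead has dropped. -/
theorem exists_hasLead {b : Module.Basis ι K A} {a : A} {S : Set ι}
    (ha : a ∈ Submodule.span K (b '' S)) (h0 : a ≠ 0) : ∃ p ∈ S, HasLead b a p := by
  have hne : (b.repr a).support.Nonempty := by
    rw [Finsupp.support_nonempty_iff]
    simpa using h0
  refine ⟨(b.repr a).support.max' hne, b.mem_span_image.1 ha ((b.repr a).support.max'_mem hne),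
    b.repr a ((b.repr a).support.max' hne),
    Finsupp.mem_support_iff.1 ((b.repr a).support.max'_mem hne), ?_⟩
  rw [b.mem_span_image]
  intro r hr
  rw [Finset.mem_coe, Finsupp.mem_support_iff] at hr
  have hrp : r ≠ (b.repr a).support.max' hne := by
    intro h
    apply hr
    rw [map_sub, map_smul, b.repr_self, Finsupp.sub_apply, Finsupp.smul_apply, h]
    simp
  refine lt_of_le_of_ne (Finset.le_max' _ _ ?_) hrp
  rw [Finsupp.mem_support_iff]
  simpa [Finsupp.single_apply, hrp.symm] using hr

theorem HasLead.sub_smul_mem {b : Module.Basis ι K A} {a a' : A} {p : ι} (h : HasLead b a p)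
    (h' : HasLead b a' p) : ∃ c : K, a' - c • a ∈ Submodule.span K (b '' Set.Iio p) := by
  obtain ⟨c, hc, h⟩ := h
  obtain ⟨c', -, h'⟩ := h'
  refine ⟨c' * c⁻¹, ?_⟩
  have key : a' - (c' * c⁻¹) • a = (a' - c' • b p) - (c' * c⁻¹) • (a - c • b p) := by
    rw [smul_sub, smul_smul, mul_assoc, inv_mul_cancel₀ hc, mul_one]
    abel
  rw [key]
  exact sub_mem h' (Submodule.smul_mem _ _ h)

variable [AddCommMonoid ι]

/-- `b p * b q` is a nonzero multiple of `b (p + q)` up to lower terms. -/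
def IsLeadMultiplicative (b : Module.Basis ι K A) : Prop :=
  ∀ p q, HasLead b (b p * b q) (p + q)

theorem IsLeadMultiplicative.mul_mem_span {b : Module.Basis ι K A} (hb : IsLeadMultiplicative b)
    {S T : Set ι} {p : ι} (hST : ∀ r ∈ S, ∀ s ∈ T, r + s < p) {a a' : A}
    (ha : a ∈ Submodule.span K (b '' S)) (ha' : a' ∈ Submodule.span K (b '' T)) :
    a * a' ∈ Submodule.span K (b '' Set.Iio p) := by
  have h := Submodule.mul_mem_mul ha ha'
  rw [Submodule.span_mul_span] at h
  refine (Submodule.span_le.2 ?_) h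
  rintro _ ⟨_, ⟨r, hr, rfl⟩, _, ⟨s, hs, rfl⟩, rfl⟩
  exact Submodule.span_mono (Set.image_mono fun t ht => lt_of_le_of_lt ht (hST r hr s hs))
    (hb r s).mem_span

/-- The condition is symmetric because addition of exponents is commutative; right Noetherianity
thus reduces to the left case. -/
theorem IsLeadMultiplicative.op {b : Module.Basis ι K A} (hb : IsLeadMultiplicative b) :
    IsLeadMultiplicative (b.map (MulOpposite.opLinearEquiv K)) := by
  intro p q
  obtain ⟨c, hc, h⟩ := hb q p
  refine ⟨c, hc, ?_⟩
  have h' := Submodule.mem_map_of_mem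
    (f := (MulOpposite.opLinearEquiv K : A ≃ₗ[K] Aᵐᵒᵖ).toLinearMap) h
  rw [Submodule.map_span, ← Set.image_comp, add_comm q p] at h'
  have hop : ⇑(b.map (MulOpposite.opLinearEquiv K)) = fun r => MulOpposite.op (b r) := by
    ext1 r
    simp
  rw [hop]
  simpa [Function.comp_def] using h'

variable [IsOrderedCancelAddMonoid ι]

theorem HasLead.mul {b : Module.Basis ι K A} (hb : IsLeadMultiplicative b) {a a' : A} {p q : ι}
    (h : HasLead b a p) (h' : HasLead b a' q) : HasLead b (a * a') (p + q) := by
  obtain ⟨c, hc, hl⟩ := h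
  obtain ⟨c', hc', hl'⟩ := id h'
  obtain ⟨d, hd, hm⟩ := hb p q
  refine ⟨c * c' * d, by positivity, ?_⟩
  have key : a * a' - (c * c' * d) • b (p + q) =
      (a - c • b p) * a' + c • (b p * (a' - c' • b q)) +
        (c * c') • (b p * b q - d • b (p + q)) := by
    simp only [sub_mul, mul_sub, smul_sub, smul_mul_assoc, mul_smul_comm, smul_smul]
    abel
  rw [key]
  refine add_mem (add_mem ?_ (Submodule.smul_mem _ _ ?_)) (Submodule.smul_mem _ _ hm)
  · exact hb.mul_mem_span (fun r hr s hs => add_lt_add_of_lt_of_le hr hs) hl h'.mem_span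
  · exact hb.mul_mem_span (fun r hr s hs => add_lt_add_of_le_of_lt hr hs)
      (hasLead_basis b p).mem_span hl'

theorem IsLeadMultiplicative.isDomain [Nontrivial A] {b : Module.Basis ι K A}
    (hb : IsLeadMultiplicative b) : IsDomain A := by
  have : NoZeroDivisors A := ⟨by
    intro x y hxy
    by_contra! h
    obtain ⟨p, -, hp⟩ := exists_hasLead (S := Set.univ) (b := b) (a := x) (by simp) h.1
    obtain ⟨q, -, hq⟩ := exists_hasLead (S := Set.univ) (b := b) (a := y) (by simp) h.2
    exact (hp.mul hb hq).ne_zero hxy⟩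
  exact NoZeroDivisors.to_isDomain A

/-- A Gröbner-type argument. In a strictly increasing chain of left ideals, choose in each step a
new element of minimal leading exponent. By hypothesis some later exponent is a translate of an
earlier one, so a left multiple of the earlier element cancels the later lead, which contradicts
minimality. -/
theorem IsLeadMultiplicative.isNoetherianRing [WellFoundedLT ι] {b : Module.Basis ι K A}
    (hb : IsLeadMultiplicative b) (hι : WellQuasiOrdered fun p q : ι => ∃ r, q = r + p) :
    IsNoetherianRing A := by
  rw [IsNoetherianRing, isNoetherian_iff', WellFoundedGT, isWellFounded_iff,
    RelEmbedding.wellFounded_iff_isEmpty]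
  refine ⟨fun f => ?_⟩
  have hf : ∀ i j, i < j → f i < f j := fun i j hij => f.map_rel_iff.2 hij
  have hex : ∀ k, ∃ p, ∃ a ∈ f (k + 1), a ∉ f k ∧ HasLead b a p := fun k => by
    obtain ⟨a, ha, hak⟩ := SetLike.exists_of_lt (hf k (k + 1) (Nat.lt_succ_self k))
    obtain ⟨p, -, hp⟩ := exists_hasLead (S := Set.univ) (b := b) (a := a) (by simp)
      (fun h => hak (h ▸ zero_mem _))
    exact ⟨p, a, ha, hak, hp⟩
  choose p hp hmin using fun k => WellFounded.has_min wellFounded_lt _ (hex k)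
  obtain ⟨i, j, hij, r, hr⟩ := hι p
  obtain ⟨a, ha, -, hap⟩ := hp i
  obtain ⟨a', ha', haj, hap'⟩ := hp j
  have hlead := (hasLead_basis b r).mul hb hap
  rw [← hr] at hlead
  -- The element `a` lies in `f (i + 1)`, and `i + 1 ≤ j`.
  have haf : a ∈ f j := by
    rcases (Nat.succ_le_of_lt hij).eq_or_lt with h | h
    · exact h ▸ ha
    · exact (hf _ _ h).le ha
  obtain ⟨c, hc⟩ := hlead.sub_smul_mem hap'
  have hmem : c • (b r * a) ∈ f j := by
    rw [← smul_mul_assoc]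
    exact (f j).smul_mem (c • b r) haf
  -- The reduced element is still new at stage `j`, yet its lead lies strictly below `p j`.
  have hnot : a' - c • (b r * a) ∉ f j := fun h => haj (by simpa using add_mem h hmem)
  obtain ⟨s, hs, hlead'⟩ := exists_hasLead hc (fun h => hnot (h ▸ zero_mem _))
  exact hmin j s ⟨_, sub_mem ha' ((hf j (j + 1) (Nat.lt_succ_self j)).le hmem), hnot, hlead'⟩ hs

end LeadingTerm

/-! ### Ordered monomials in skew-commuting families -/

section OrdMonomial

variable {K A : Type*} [Field K] [Ring A] [Algebra K A]

/-- The ordered monomial `x_1 ^ I_1 ⋯ x_n ^ I_n`. -/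
def ordMonomial {A : Type*} [Ring A] {n : ℕ} (x : Fin n → A) (I : Fin n → ℕ) : A :=
  (List.ofFn fun k => x k ^ I k).prod

theorem ordMonomial_succ {n : ℕ} (x : Fin (n + 1) → A) (I : Fin (n + 1) → ℕ) :
    ordMonomial x I = x 0 ^ I 0 * ordMonomial (fun k => x k.succ) (fun k => I k.succ) := by
  simp [ordMonomial, List.ofFn_succ]

@[simp] theorem ordMonomial_zero {n : ℕ} (x : Fin n → A) : ordMonomial x 0 = 1 := by
  simp [ordMonomial, List.ofFn_const]

theorem map_ordMonomial {B F : Type*} [Ring B] [FunLike F A B] [MonoidHomClass F A B] {n : ℕ}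
    (f : F) (x : Fin n → A) (I : Fin n → ℕ) :
    f (ordMonomial x I) = ordMonomial (fun k => f (x k)) I := by
  simp [ordMonomial, map_list_prod, List.map_ofFn, Function.comp_def]

/-- A relation between elements and exponents that is multiplicative and holds for the `x k` holds
for ordered monomials. -/
theorem ordMonomial_induction {M : Type*} [AddCommMonoid M] {P : A → M → Prop} (h1 : P 1 0)
    (hmul : ∀ a b d e, P a d → P b e → P (a * b) (d + e)) {n : ℕ} (x : Fin n → A) (e : Fin n → M)
    (hx : ∀ k, P (x k) (e k)) (I : Fin n → ℕ) : P (ordMonomial x I) (∑ k, I k • e k) := by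
  have hpow : ∀ a d (m : ℕ), P a d → P (a ^ m) (m • d) := fun a d m h => by
    induction m with
    | zero => simpa using h1
    | succ m ih =>
      rw [pow_succ, succ_nsmul]
      exact hmul _ _ _ _ ih h
  induction n with
  | zero => simpa [ordMonomial] using h1
  | succ n ih =>
    rw [ordMonomial_succ, Fin.sum_univ_succ]
    exact hmul _ _ _ _ (hpow _ _ _ (hx 0)) (ih _ _ (fun k => hx k.succ) _)

theorem mul_pow_of_skew {y z : A} {c : Kˣ} (h : y * z = (c : K) • (z * y)) (m : ℕ) :
    y * z ^ m = ((c ^ m : Kˣ) : K) • (z ^ m * y) := by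
  induction m with
  | zero => simp
  | succ m ih =>
    rw [pow_succ, ← mul_assoc, ih, smul_mul_assoc, mul_assoc, h, mul_smul_comm, smul_smul,
      ← mul_assoc, pow_succ, Units.val_mul]

theorem pow_mul_of_skew {y z : A} {c : Kˣ} (h : z * y = (c : K) • (y * z)) (m : ℕ) :
    z ^ m * y = ((c ^ m : Kˣ) : K) • (y * z ^ m) := by
  induction m with
  | zero => simp
  | succ m ih =>
    rw [pow_succ', mul_assoc, ih, mul_smul_comm, ← mul_assoc, h, smul_mul_assoc, smul_smul,
      mul_assoc, pow_succ, Units.val_mul]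

theorem mul_ordMonomial_of_skew {n : ℕ} {x : Fin n → A} {y : A} {c : Fin n → Kˣ}
    (h : ∀ k, y * x k = (c k : K) • (x k * y)) (I : Fin n → ℕ) :
    y * ordMonomial x I = ((∏ k, c k ^ I k : Kˣ) : K) • (ordMonomial x I * y) := by
  induction n with
  | zero => simp [ordMonomial]
  | succ n ih =>
    rw [ordMonomial_succ, ← mul_assoc, mul_pow_of_skew (h 0), smul_mul_assoc, mul_assoc,
      ih (fun k => h k.succ), mul_smul_comm, smul_smul, ← mul_assoc, Fin.prod_univ_succ,
      Units.val_mul]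

theorem ordMonomial_mul_of_skew {n : ℕ} {x : Fin n → A} {y : A} {c : Fin n → Kˣ}
    (h : ∀ k, x k * y = (c k : K) • (y * x k)) (I : Fin n → ℕ) :
    ordMonomial x I * y = ((∏ k, c k ^ I k : Kˣ) : K) • (y * ordMonomial x I) := by
  induction n with
  | zero => simp [ordMonomial]
  | succ n ih =>
    rw [ordMonomial_succ, mul_assoc, ih (fun k => h k.succ), mul_smul_comm, ← mul_assoc,
      pow_mul_of_skew (h 0), smul_mul_assoc, smul_smul, mul_assoc, Fin.prod_univ_succ,
      Units.val_mul, mul_comm]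

/-- The truncated exponent `m - 1` is harmless: for `m = 0` its coefficient vanishes. -/
theorem mul_pow_of_weyl {y z : A} (h : y * z = z * y + 1) (m : ℕ) :
    y * z ^ m = z ^ m * y + (m : K) • z ^ (m - 1) := by
  induction m with
  | zero => simp
  | succ m ih =>
    rw [pow_succ, ← mul_assoc, ih, add_mul, mul_assoc, h, mul_add, mul_one, smul_mul_assoc,
      Nat.add_sub_cancel, mul_assoc]
    rcases m with _ | m
    · simp
    · rw [Nat.add_sub_cancel, ← pow_succ, add_assoc, Nat.cast_succ (m + 1), add_smul, one_smul,
        add_comm (z ^ (m + 1))]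

theorem pow_mul_of_weyl {y z : A} (h : z * y = y * z + 1) (m : ℕ) :
    z ^ m * y = y * z ^ m + (m : K) • z ^ (m - 1) := by
  induction m with
  | zero => simp
  | succ m ih =>
    rw [pow_succ', mul_assoc, ih, mul_add, ← mul_assoc, h, add_mul, one_mul, mul_smul_comm,
      Nat.add_sub_cancel, mul_assoc]
    rcases m with _ | m
    · simp
    · rw [Nat.add_sub_cancel, ← pow_succ', ← pow_succ', add_assoc, Nat.cast_succ (m + 1), add_smul,
        one_smul, add_comm (z ^ (m + 1))]

theorem succ_sub_single_zero {n : ℕ} (I : Fin (n + 1) → ℕ) :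
    (fun k : Fin n => (I - Pi.single 0 1 : Fin (n + 1) → ℕ) k.succ) = fun k => I k.succ := by
  ext k
  simp

theorem succ_sub_single_succ {n : ℕ} (I : Fin (n + 1) → ℕ) (j : Fin n) :
    (fun k : Fin n => (I - Pi.single j.succ 1 : Fin (n + 1) → ℕ) k.succ) = (fun k => I k.succ) - Pi.single j 1 := by
  ext k
  simp [Pi.single_apply]

theorem succ_add_single_zero {n : ℕ} (I : Fin (n + 1) → ℕ) :
    (fun k : Fin n => (I + Pi.single 0 1 : Fin (n + 1) → ℕ) k.succ) = fun k => I k.succ := by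
  ext k
  simp

theorem succ_add_single_succ {n : ℕ} (I : Fin (n + 1) → ℕ) (j : Fin n) :
    (fun k : Fin n => (I + Pi.single j.succ 1 : Fin (n + 1) → ℕ) k.succ) = (fun k => I k.succ) + Pi.single j 1 := by
  ext k
  simp [Pi.single_apply]

/-- Moving `y` to the right through an ordered monomial, if `y` skew-commutes with the `x k` up to
the Weyl relation `y * x i = x i * y + 1`. -/
theorem mul_ordMonomial_of_weyl {n : ℕ} {x : Fin n → A} {y : A} {c : Fin n → Kˣ} {i : Fin n}
    (hci : c i = 1) (h : ∀ k, y * x k = (c k : K) • (x k * y) + if k = i then 1 else 0)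
    (I : Fin n → ℕ) :
    ∃ d : Kˣ, y * ordMonomial x I = ((∏ k, c k ^ I k : Kˣ) : K) • (ordMonomial x I * y) +
      (I i * d : K) • ordMonomial x (I - Pi.single i 1) := by
  induction n with
  | zero => exact i.elim0
  | succ n ih =>
    rw [ordMonomial_succ x I, ordMonomial_succ x (I - _)]
    cases i using Fin.cases with
    | zero =>
      have h0 : y * x 0 = x 0 * y + 1 := by simpa [hci] using h 0
      have hs : ∀ k : Fin n, y * x k.succ = (c k.succ : K) • (x k.succ * y) := fun k => by
        simpa using h k.succ
      refine ⟨1, ?_⟩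
      rw [succ_sub_single_zero, ← mul_assoc, mul_pow_of_weyl (K := K) h0, add_mul, mul_assoc,
        mul_ordMonomial_of_skew hs, mul_smul_comm, ← mul_assoc, Fin.prod_univ_succ, hci]
      simp
    | succ j =>
      have h0 : y * x 0 = (c 0 : K) • (x 0 * y) := by
        simpa [(Fin.succ_ne_zero j).symm] using h 0
      obtain ⟨d, hd⟩ := ih (x := fun k => x k.succ) (c := fun k => c k.succ) (i := j) hci
        (fun k => by simpa using h k.succ) (fun k => I k.succ)
      -- Crossing `x 0 ^ I 0` contributes `c 0 ^ I 0` before the Weyl relation is used in the tail.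
      refine ⟨c 0 ^ I 0 * d, ?_⟩
      rw [succ_sub_single_succ, ← mul_assoc, mul_pow_of_skew h0, smul_mul_assoc, mul_assoc, hd,
        Fin.prod_univ_succ, mul_add, smul_add, mul_smul_comm, mul_smul_comm, smul_smul, smul_smul,
        ← mul_assoc]
      simp only [Units.val_mul, Pi.sub_apply,
        Pi.single_eq_of_ne (M := fun _ => ℕ) (Fin.succ_ne_zero j).symm, Nat.sub_zero]
      congr 2
      ring

/-- Moving `y` to the left through an ordered monomial, if `y` skew-commutes with the `x k` up to
the Weyl relation `x i * y = y * x i + 1`. -/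
theorem ordMonomial_mul_of_weyl {n : ℕ} {x : Fin n → A} {y : A} {c : Fin n → Kˣ} {i : Fin n}
    (hci : c i = 1) (h : ∀ k, x k * y = (c k : K) • (y * x k) + if k = i then 1 else 0)
    (I : Fin n → ℕ) :
    ∃ d : Kˣ, ordMonomial x I * y = ((∏ k, c k ^ I k : Kˣ) : K) • (y * ordMonomial x I) +
      (I i * d : K) • ordMonomial x (I - Pi.single i 1) := by
  induction n with
  | zero => exact i.elim0
  | succ n ih =>
    rw [ordMonomial_succ x I, ordMonomial_succ x (I - _)]
    cases i using Fin.cases with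
    | zero =>
      have h0 : x 0 * y = y * x 0 + 1 := by simpa [hci] using h 0
      have hs : ∀ k : Fin n, x k.succ * y = (c k.succ : K) • (y * x k.succ) := fun k => by
        simpa using h k.succ
      -- Here `y` crosses the whole tail before it meets `x 0`.
      refine ⟨∏ k, c (Fin.succ k) ^ I k.succ, ?_⟩
      rw [succ_sub_single_zero, mul_assoc, ordMonomial_mul_of_skew hs, mul_smul_comm, ← mul_assoc,
        pow_mul_of_weyl (K := K) h0, add_mul, smul_add, smul_mul_assoc, smul_smul,
        Fin.prod_univ_succ, hci, mul_assoc]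
      simp [mul_comm]
    | succ j =>
      have h0 : x 0 * y = (c 0 : K) • (y * x 0) := by
        simpa [(Fin.succ_ne_zero j).symm] using h 0
      obtain ⟨d, hd⟩ := ih (x := fun k => x k.succ) (c := fun k => c k.succ) (i := j) hci
        (fun k => by simpa using h k.succ) (fun k => I k.succ)
      refine ⟨d, ?_⟩
      rw [succ_sub_single_succ, mul_assoc, hd, mul_add, mul_smul_comm, mul_smul_comm, ← mul_assoc,
        pow_mul_of_skew h0, smul_mul_assoc, smul_smul, Fin.prod_univ_succ, mul_assoc,
        mul_comm (c 0 ^ I 0), Units.val_mul]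
      simp only [Pi.sub_apply,
        Pi.single_eq_of_ne (M := fun _ => ℕ) (Fin.succ_ne_zero j).symm, Nat.sub_zero]

theorem mul_ordMonomial_self {n : ℕ} {x : Fin n → A} {c : Fin n → Fin n → Kˣ}
    (h : ∀ i j, x i * x j = (c i j : K) • (x j * x i)) (i : Fin n) (I : Fin n → ℕ) :
    ∃ d : Kˣ, x i * ordMonomial x I = (d : K) • ordMonomial x (I + Pi.single i 1) := by
  induction n with
  | zero => exact i.elim0
  | succ n ih =>
    rw [ordMonomial_succ x I, ordMonomial_succ x (I + _)]
    cases i using Fin.cases with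
    | zero =>
      refine ⟨1, ?_⟩
      rw [succ_add_single_zero, ← mul_assoc]
      simp [pow_succ']
    | succ j =>
      obtain ⟨d, hd⟩ := ih (x := fun k => x k.succ) (c := fun k l => c k.succ l.succ)
        (fun k l => h _ _) j (fun k => I k.succ)
      refine ⟨c j.succ 0 ^ I 0 * d, ?_⟩
      rw [succ_add_single_succ, ← mul_assoc, mul_pow_of_skew (h j.succ 0), smul_mul_assoc,
        mul_assoc, hd, mul_smul_comm, smul_smul]
      simp

/-- The commutator with `y` is a derivation and each `x k` is an eigenvector, so eigenvalues add up
along the monomial. -/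
theorem commutator_ordMonomial {n : ℕ} {x : Fin n → A} {y : A} {c : Fin n → K}
    (h : ∀ k, y * x k = x k * y + c k • x k) (I : Fin n → ℕ) :
    y * ordMonomial x I = ordMonomial x I * y + (∑ k, I k * c k) • ordMonomial x I := by
  have key := ordMonomial_induction (P := fun a (e : K) => y * a = a * y + e • a) (by simp)
    (fun a b d e ha hb => by
      rw [← mul_assoc, ha, add_mul, mul_assoc, hb, mul_add, smul_mul_assoc, mul_smul_comm,
        ← mul_assoc, add_smul, add_assoc, add_comm (e • _)]) x c h I
  simpa using key

end OrdMonomial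

/-! ### Families satisfying the relations of the quantized Weyl algebra -/

section WeylSystem

variable {K A : Type*} [Field K] [Ring A] [Algebra K A] {n : ℕ}

/-- The relations of `A_n^Λ` for `Λ` the transpose of `Q`. -/
structure IsWeylSystem (Q : QuantumMatrix K n) (u v : Fin n → A) : Prop where
  vv : ∀ i j, v i * v j = (Q.entry j i : K) • (v j * v i)
  uu : ∀ i j, u i * u j = (Q.entry j i : K) • (u j * u i)
  uv : ∀ i j, u i * v j = (Q.entry i j : K) • (v j * u i) + if j = i then 1 else 0

/-- The monomial `v_I * u_J`. -/
def weylMonomial {A : Type*} [Ring A] {n : ℕ} (u v : Fin n → A)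
    (p : (Fin n → ℕ) × (Fin n → ℕ)) : A :=
  ordMonomial v p.1 * ordMonomial u p.2

/-- The scalar `∏ k, q_ik ^ I_k`. -/
def QuantumMatrix.twist (Q : QuantumMatrix K n) (i : Fin n) (I : Fin n → ℕ) : Kˣ :=
  ∏ k, Q.entry i k ^ I k

theorem QuantumMatrix.twist_add (Q : QuantumMatrix K n) (i : Fin n) (I J : Fin n → ℕ) :
    Q.twist i (I + J) = Q.twist i I * Q.twist i J := by
  simp [twist, pow_add, Finset.prod_mul_distrib]

theorem QuantumMatrix.entry_inv (Q : QuantumMatrix K n) (i j : Fin n) :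
    (Q.entry i j)⁻¹ = Q.entry j i :=
  inv_eq_of_mul_eq_one_right (Q.antisymm i j)

theorem QuantumMatrix.twist_inv (Q : QuantumMatrix K n) (i : Fin n) (I : Fin n → ℕ) :
    (Q.twist i I)⁻¹ = ∏ k, Q.entry k i ^ I k := by
  simp [twist, ← entry_inv Q i, Finset.prod_inv_distrib]

theorem weylMonomial_def (u v : Fin n → A) (p : (Fin n → ℕ) × (Fin n → ℕ)) :
    weylMonomial u v p = ordMonomial v p.1 * ordMonomial u p.2 :=
  rfl

namespace IsWeylSystem

variable {Q : QuantumMatrix K n} {u v : Fin n → A}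

/-! ### Commuting generators with sorted monomials. -/

theorem v_mul_weylMonomial (h : IsWeylSystem Q u v) (i : Fin n)
    (p : (Fin n → ℕ) × (Fin n → ℕ)) :
    ∃ d : Kˣ, v i * weylMonomial u v p = (d : K) • weylMonomial u v (p + (Pi.single i 1, 0)) := by
  obtain ⟨d, hd⟩ := mul_ordMonomial_self h.vv i p.1
  refine ⟨d, ?_⟩
  rw [weylMonomial, ← mul_assoc, hd, smul_mul_assoc, weylMonomial, Prod.fst_add, Prod.snd_add,
    add_zero]

/-- A halfway form with `u i` between the two blocks. From here `u i` is either sorted into the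
`u`-block or pulled out to the right. -/
theorem u_mul_weylMonomial_eq (h : IsWeylSystem Q u v) (i : Fin n)
    (p : (Fin n → ℕ) × (Fin n → ℕ)) :
    ∃ d : Kˣ, u i * weylMonomial u v p =
      (Q.twist i p.1 : K) • (ordMonomial v p.1 * (u i * ordMonomial u p.2)) +
        (p.1 i * d : K) • weylMonomial u v (p - (Pi.single i 1, 0)) := by
  obtain ⟨d, hd⟩ := mul_ordMonomial_of_weyl (Q.diag i) (h.uv i) p.1
  refine ⟨d, ?_⟩
  rw [weylMonomial_def u v p, ← mul_assoc, hd, add_mul, smul_mul_assoc, smul_mul_assoc, mul_assoc,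
    weylMonomial_def, Prod.fst_sub, Prod.snd_sub, tsub_zero]
  rfl

theorem u_mul_weylMonomial (h : IsWeylSystem Q u v) (i : Fin n)
    (p : (Fin n → ℕ) × (Fin n → ℕ)) :
    ∃ c d : Kˣ, u i * weylMonomial u v p = (c : K) • weylMonomial u v (p + (0, Pi.single i 1)) +
      (p.1 i * d : K) • weylMonomial u v (p - (Pi.single i 1, 0)) := by
  obtain ⟨d, hd⟩ := h.u_mul_weylMonomial_eq i p
  obtain ⟨c, hc⟩ := mul_ordMonomial_self h.uu i p.2
  refine ⟨Q.twist i p.1 * c, d, ?_⟩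
  rw [hd, hc, mul_smul_comm, smul_smul, Units.val_mul, weylMonomial_def u v (p + _),
    Prod.fst_add, Prod.snd_add, add_zero]

/-- Up to the twist, the skew-commutator with `u i` is a partial derivative in `v i`. The twist
depends only on `p.1 - p.2`, see `twist_eq_of_sub_eq`. -/
theorem u_mul_weylMonomial_comm (h : IsWeylSystem Q u v) (i : Fin n)
    (p : (Fin n → ℕ) × (Fin n → ℕ)) :
    ∃ d : Kˣ, u i * weylMonomial u v p =
      ((Q.twist i p.1 * (Q.twist i p.2)⁻¹ : Kˣ) : K) • (weylMonomial u v p * u i) +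
        (p.1 i * d : K) • weylMonomial u v (p - (Pi.single i 1, 0)) := by
  obtain ⟨d, hd⟩ := h.u_mul_weylMonomial_eq i p
  refine ⟨d, ?_⟩
  have hu := ordMonomial_mul_of_skew (fun k => h.uu k i) p.2
  rw [hd, weylMonomial_def u v p, mul_assoc (ordMonomial v p.1), hu, mul_smul_comm, smul_smul,
    ← Units.val_mul]
  simp [QuantumMatrix.twist]

/-- The mirror image, a partial derivative in `u i`, with the same twist. -/
theorem weylMonomial_mul_v_comm (h : IsWeylSystem Q u v) (i : Fin n)
    (p : (Fin n → ℕ) × (Fin n → ℕ)) :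
    ∃ d : Kˣ, weylMonomial u v p * v i =
      ((Q.twist i p.1 * (Q.twist i p.2)⁻¹ : Kˣ) : K) • (v i * weylMonomial u v p) +
        (p.2 i * d : K) • weylMonomial u v (p - (0, Pi.single i 1)) := by
  obtain ⟨d, hd⟩ := ordMonomial_mul_of_weyl (y := v i) (i := i) (x := u)
    (c := fun k => Q.entry k i) (Q.diag i)
    (fun k => by rw [h.uv k i]; simp only [eq_comm]) p.2
  have hv := ordMonomial_mul_of_skew (fun k => h.vv k i) p.1
  refine ⟨d, ?_⟩
  rw [weylMonomial_def u v p, mul_assoc, hd, mul_add, mul_smul_comm, mul_smul_comm, ← mul_assoc,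
    hv, smul_mul_assoc, smul_smul, mul_assoc (v i), ← Q.twist_inv, mul_comm (Q.twist i p.1),
    Units.val_mul, weylMonomial_def, Prod.fst_sub, Prod.snd_sub, tsub_zero]
  rfl

/-- In `v i * u i` the skew scalars cancel by `q_ik q_ki = 1`, so commutation with it is diagonal:
`v i` has weight `1`, `u i` has weight `-1`, the other generators have weight `0`. -/
theorem vu_mul_weylMonomial (h : IsWeylSystem Q u v) (i : Fin n)
    (p : (Fin n → ℕ) × (Fin n → ℕ)) :
    v i * u i * weylMonomial u v p = weylMonomial u v p * (v i * u i) +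
      ((p.1 i : K) - p.2 i) • weylMonomial u v p := by
  have hq : ∀ k, (Q.entry i k : K) * (Q.entry k i : K) = 1 := fun k => by
    rw [← Units.val_mul, Q.antisymm, Units.val_one]
  have hv : ∀ k, v i * u i * v k = v k * (v i * u i) + (if k = i then (1 : K) else 0) • v k := by
    intro k
    rw [mul_assoc, h.uv, mul_add, mul_smul_comm, ← mul_assoc, h.vv i k, smul_mul_assoc, smul_smul,
      hq, one_smul, mul_assoc]
    split_ifs with hk
    · rw [hk, one_smul, mul_one]
    · rw [zero_smul, mul_zero]
  have hu : ∀ k, v i * u i * u k = u k * (v i * u i) + (if k = i then (-1 : K) else 0) • u k := by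
    intro k
    rw [← mul_assoc (u k), h.uv k i, mul_assoc, h.uu i k, mul_smul_comm, add_mul, smul_mul_assoc,
      mul_assoc]
    by_cases hk : k = i
    · subst hk
      simp
    · simp [hk, Ne.symm hk]
  have hv' := commutator_ordMonomial hv p.1
  have hu' := commutator_ordMonomial hu p.2
  rw [weylMonomial_def, ← mul_assoc, hv', add_mul, mul_assoc (ordMonomial v p.1), hu', mul_add,
    ← mul_assoc, smul_mul_assoc, mul_smul_comm, add_assoc, ← add_smul]
  congr 2
  simp
  ring

/-! #### Leading terms -/

/-- `a` is a nonzero multiple of the monomial of exponent `p` plus a combination of monomials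
whose exponents are componentwise smaller. -/
def _root_.HasWeylLead (K : Type*) {A : Type*} [Field K] [Ring A] [Algebra K A] {n : ℕ}
    (u v : Fin n → A) (a : A) (p : (Fin n → ℕ) × (Fin n → ℕ)) : Prop :=
  ∃ c : K, c ≠ 0 ∧
    a - c • weylMonomial u v p ∈ Submodule.span K (weylMonomial u v '' Set.Iio p)

theorem _root_.HasWeylLead.mem_span {a : A} {p : (Fin n → ℕ) × (Fin n → ℕ)}
    (h : HasWeylLead K u v a p) : a ∈ Submodule.span K (weylMonomial u v '' Set.Iic p) := by
  obtain ⟨c, -, h⟩ := h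
  rw [← sub_add_cancel a (c • weylMonomial u v p)]
  exact add_mem (Submodule.span_mono (Set.image_mono Set.Iio_subset_Iic_self) h)
    (Submodule.smul_mem _ _ (Submodule.subset_span ⟨p, Set.mem_Iic.2 le_rfl, rfl⟩))

/-- If left multiplication by `g` shifts the exponents of monomials by `e`, then it shifts all
leading exponents by `e`. -/
theorem _root_.HasWeylLead.mul_left {g : A} {e : (Fin n → ℕ) × (Fin n → ℕ)}
    (hg : ∀ p, HasWeylLead K u v (g * weylMonomial u v p) (e + p)) {a : A}
    {p : (Fin n → ℕ) × (Fin n → ℕ)} (ha : HasWeylLead K u v a p) :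
    HasWeylLead K u v (g * a) (e + p) := by
  obtain ⟨c, hc, ha⟩ := ha
  obtain ⟨d, hd, h⟩ := hg p
  refine ⟨c * d, mul_ne_zero hc hd, ?_⟩
  have key : g * a - (c * d) • weylMonomial u v (e + p) =
      g * (a - c • weylMonomial u v p) +
        c • (g * weylMonomial u v p - d • weylMonomial u v (e + p)) := by
    simp only [mul_sub, smul_sub, mul_smul_comm, smul_smul]
    abel
  rw [key]
  refine add_mem ?_ (Submodule.smul_mem _ _ h)
  have hle : Submodule.span K (weylMonomial u v '' Set.Iio p) ≤
      (Submodule.span K (weylMonomial u v '' Set.Iio (e + p))).comap (LinearMap.mulLeft K g) := by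
    rw [Submodule.span_le]
    rintro _ ⟨r, hr, rfl⟩
    exact Submodule.span_mono
      (Set.image_mono fun t ht => lt_of_le_of_lt ht (add_lt_add_right (Set.mem_Iio.1 hr) e))
      (hg r).mem_span
  exact hle ha

theorem hasWeylLead_v_mul (h : IsWeylSystem Q u v) (i : Fin n) (p : (Fin n → ℕ) × (Fin n → ℕ)) :
    HasWeylLead K u v (v i * weylMonomial u v p) ((Pi.single i 1, 0) + p) := by
  obtain ⟨d, hd⟩ := h.v_mul_weylMonomial i p
  exact ⟨d, d.ne_zero, by simp [hd, add_comm p]⟩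

theorem hasWeylLead_u_mul (h : IsWeylSystem Q u v) (i : Fin n) (p : (Fin n → ℕ) × (Fin n → ℕ)) :
    HasWeylLead K u v (u i * weylMonomial u v p) ((0, Pi.single i 1) + p) := by
  obtain ⟨c, d, hd⟩ := h.u_mul_weylMonomial i p
  refine ⟨c, c.ne_zero, ?_⟩
  rw [hd, add_comm p, add_sub_cancel_left]
  refine Submodule.smul_mem _ _ (Submodule.subset_span ⟨_, ?_, rfl⟩)
  -- The truncated difference is at most `p` in every case, hence strictly below the leading
  -- exponent.
  refine lt_of_le_of_lt tsub_le_self (lt_add_of_pos_left p ?_)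
  exact Prod.mk_lt_mk.2 (Or.inr ⟨le_rfl, Pi.single_pos.2 one_pos⟩)

theorem _root_.sum_smul_single {n : ℕ} (I : Fin n → ℕ) : ∑ k, I k • Pi.single k 1 = I := by
  ext j
  simp [Finset.sum_apply, Pi.single_apply]

/-- Shifting all leading exponents by `e` under left multiplication is a property of pairs `(g, e)`
that is stable under products, so the generators suffice. The componentwise order is kept, being
finer information than the lexicographic one: the dimension count needs it. -/
theorem hasWeylLead_mul (h : IsWeylSystem Q u v) (p q : (Fin n → ℕ) × (Fin n → ℕ)) :
    HasWeylLead K u v (weylMonomial u v p * weylMonomial u v q) (p + q) := by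
  let P : A → (Fin n → ℕ) × (Fin n → ℕ) → Prop := fun g e =>
    ∀ a p, HasWeylLead K u v a p → HasWeylLead K u v (g * a) (e + p)
  have h1 : P 1 0 := fun a p ha => by simpa using ha
  have hmul : ∀ a b d e, P a d → P b e → P (a * b) (d + e) := fun a b d e ha hb x p hx => by
    rw [mul_assoc, add_assoc]
    exact ha _ _ (hb _ _ hx)
  have hv := ordMonomial_induction h1 hmul v (fun k => (Pi.single k 1, 0))
    (fun k a p ha => HasWeylLead.mul_left (h.hasWeylLead_v_mul k) ha) p.1
  have hu := ordMonomial_induction h1 hmul u (fun k => (0, Pi.single k 1))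
    (fun k a p ha => HasWeylLead.mul_left (h.hasWeylLead_u_mul k) ha) p.2
  have hp : P (weylMonomial u v p) p := by
    have := hmul _ _ _ _ hv hu
    have hsum : ∑ k, p.1 k • ((Pi.single k 1, 0) : (Fin n → ℕ) × (Fin n → ℕ)) +
        ∑ k, p.2 k • ((0, Pi.single k 1) : (Fin n → ℕ) × (Fin n → ℕ)) = p := by
      apply Prod.ext
      · simpa [Prod.fst_sum] using sum_smul_single p.1
      · simpa [Prod.snd_sum] using sum_smul_single p.2
    rwa [hsum] at this
  exact hp _ _ ⟨1, one_ne_zero, by simp⟩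

/-- The monomials span if the generators generate. -/
theorem span_weylMonomial (h : IsWeylSystem Q u v)
    (hgen : Algebra.adjoin K (Set.range u ∪ Set.range v) = ⊤) :
    Submodule.span K (Set.range (weylMonomial u v)) = ⊤ := by
  have hstep : ∀ g : A, (∀ p, ∃ q, HasWeylLead K u v (g * weylMonomial u v p) q) →
      ∀ a ∈ Submodule.span K (Set.range (weylMonomial u v)),
        g * a ∈ Submodule.span K (Set.range (weylMonomial u v)) := by
    intro g hg
    change Submodule.span K _ ≤ (Submodule.span K _).comap (LinearMap.mulLeft K g)
    rw [Submodule.span_le]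
    rintro _ ⟨p, rfl⟩
    obtain ⟨q, hq⟩ := hg p
    exact Submodule.span_mono (Set.image_subset_range _ _) hq.mem_span
  have hall : ∀ g : A, ∀ a ∈ Submodule.span K (Set.range (weylMonomial u v)),
      g * a ∈ Submodule.span K (Set.range (weylMonomial u v)) := by
    intro g
    have hg : g ∈ Algebra.adjoin K (Set.range u ∪ Set.range v) := hgen ▸ Algebra.mem_top
    induction hg using Algebra.adjoin_induction with
    | mem g hg =>
      rcases hg with ⟨i, rfl⟩ | ⟨i, rfl⟩
      · exact hstep _ fun p => ⟨_, h.hasWeylLead_u_mul i p⟩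
      · exact hstep _ fun p => ⟨_, h.hasWeylLead_v_mul i p⟩
    | algebraMap c =>
      intro a ha
      rw [← Algebra.smul_def]
      exact Submodule.smul_mem _ _ ha
    | add x y _ _ hx hy =>
      intro a ha
      rw [add_mul]
      exact add_mem (hx a ha) (hy a ha)
    | mul x y _ _ hx hy =>
      intro a ha
      rw [mul_assoc]
      exact hx _ (hy a ha)
  rw [eq_top_iff]
  intro g _
  simpa using hall g 1 (Submodule.subset_span ⟨0, by simp [weylMonomial]⟩)

end IsWeylSystem

end WeylSystem

section WeylRing

variable {K A : Type*} [Field K] [Ring A] [Algebra K A] {n : ℕ}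

namespace IsWeylSystem

variable {Q : QuantumMatrix K n} {u v : Fin n → A}

/-! #### Domain and Noetherian property -/

/-- The lexicographic order on exponents. -/
abbrev _root_.LexExponent (n : ℕ) : Type := Lex (Fin n → ℕ) ×ₗ Lex (Fin n → ℕ)

/-- Exponents as elements of the linearly ordered monoid `LexExponent n`. -/
def _root_.lexExponentEquiv (n : ℕ) : ((Fin n → ℕ) × (Fin n → ℕ)) ≃+ LexExponent n where
  toFun p := toLex (toLex p.1, toLex p.2)
  invFun p := (ofLex (ofLex p).1, ofLex (ofLex p).2)
  left_inv _ := rfl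
  right_inv _ := rfl
  map_add' _ _ := rfl

theorem _root_.lexExponentEquiv_strictMono (n : ℕ) : StrictMono (lexExponentEquiv n) := by
  intro p q hpq
  change toLex (toLex p.1, toLex p.2) < toLex (toLex q.1, toLex q.2)
  have h1 : toLex p.1 ≤ toLex q.1 := Pi.toLex_monotone hpq.le.1
  have h2 : toLex p.2 ≤ toLex q.2 := Pi.toLex_monotone hpq.le.2
  refine Prod.Lex.toLex_strictMono (lt_of_le_of_ne ⟨h1, h2⟩ fun h => hpq.ne ?_)
  exact Prod.ext (toLex.injective (congrArg Prod.fst h)) (toLex.injective (congrArg Prod.snd h))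

/-- Dickson's lemma. The relation is divisibility of monomials, not the lexicographic order. -/
theorem _root_.wellQuasiOrdered_lexExponent (n : ℕ) :
    WellQuasiOrdered fun p q : LexExponent n => ∃ r, q = r + p := by
  have hpi : WellQuasiOrdered fun I J : Fin n → ℕ => I ≤ J :=
    WellQuasiOrdered.pi (r := fun _ a b => a ≤ b) fun _ => wellQuasiOrdered_le
  have hprod := hpi.prod hpi
  intro f
  obtain ⟨i, j, hij, h1, h2⟩ := hprod fun k => (lexExponentEquiv n).symm (f k)
  obtain ⟨r, hr⟩ := exists_add_of_le (show (lexExponentEquiv n).symm (f i) ≤ _ from ⟨h1, h2⟩)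
  refine ⟨i, j, hij, lexExponentEquiv n r, (lexExponentEquiv n).symm.injective ?_⟩
  rw [map_add, hr, AddEquiv.symm_apply_apply, add_comm]

variable {b : Module.Basis ((Fin n → ℕ) × (Fin n → ℕ)) K A}

/-- Componentwise smaller exponents are lexicographically smaller, so `hasWeylLead_mul` transfers.
-/
theorem isLeadMultiplicative (h : IsWeylSystem Q u v) (hb : ∀ p, b p = weylMonomial u v p) :
    IsLeadMultiplicative (b.reindex (lexExponentEquiv n).toEquiv) := by
  intro p q
  obtain ⟨p, rfl⟩ := (lexExponentEquiv n).surjective p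
  obtain ⟨q, rfl⟩ := (lexExponentEquiv n).surjective q
  obtain ⟨c, hc, hl⟩ := h.hasWeylLead_mul p q
  have hb' : ∀ r, b.reindex (lexExponentEquiv n).toEquiv (lexExponentEquiv n r) =
      weylMonomial u v r := fun r => by
    rw [← hb r, Module.Basis.reindex_apply]
    rfl
  refine ⟨c, hc, ?_⟩
  rw [← map_add, hb', hb', hb']
  refine Submodule.span_mono ?_ hl
  rintro _ ⟨r, hr, rfl⟩
  exact ⟨lexExponentEquiv n r, lexExponentEquiv_strictMono n hr, hb' r⟩

theorem isDomain [Nontrivial A] (h : IsWeylSystem Q u v) (hb : ∀ p, b p = weylMonomial u v p) :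
    IsDomain A :=
  (h.isLeadMultiplicative hb).isDomain

theorem isNoetherianRing (h : IsWeylSystem Q u v) (hb : ∀ p, b p = weylMonomial u v p) :
    IsNoetherianRing A :=
  (h.isLeadMultiplicative hb).isNoetherianRing (wellQuasiOrdered_lexExponent n)

theorem isNoetherianRing_op (h : IsWeylSystem Q u v) (hb : ∀ p, b p = weylMonomial u v p) :
    IsNoetherianRing Aᵐᵒᵖ :=
  (h.isLeadMultiplicative hb).op.isNoetherianRing (wellQuasiOrdered_lexExponent n)

/-! #### Simplicity -/

/-- The total degree of an exponent. -/
def _root_.totalDegree (p : (Fin n → ℕ) × (Fin n → ℕ)) : ℕ := ∑ k, p.1 k + ∑ k, p.2 k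

theorem _root_.totalDegree_add (p q : (Fin n → ℕ) × (Fin n → ℕ)) :
    totalDegree (p + q) = totalDegree p + totalDegree q := by
  simp only [totalDegree, Prod.fst_add, Prod.snd_add, Pi.add_apply, Finset.sum_add_distrib]
  ring

/-- A measure of the size of a finitely supported function of exponents. -/
def _root_.supportSize (f : (Fin n → ℕ) × (Fin n → ℕ) →₀ K) : ℕ :=
  ∑ p ∈ f.support, (1 + totalDegree p)

/-- Since `φ` is injective where `w` does not vanish, no terms merge or cancel. The summand `1` in
`supportSize` makes the loss of a term count even when its exponent is `0`. -/
theorem _root_.supportSize_lt {f : (Fin n → ℕ) × (Fin n → ℕ) →₀ K}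
    {φ : (Fin n → ℕ) × (Fin n → ℕ) → (Fin n → ℕ) × (Fin n → ℕ)}
    {w : (Fin n → ℕ) × (Fin n → ℕ) → K}
    (hinj : ∀ p q, w p ≠ 0 → w q ≠ 0 → φ p = φ q → p = q)
    (hle : ∀ p ∈ f.support, w p ≠ 0 → totalDegree (φ p) ≤ totalDegree p)
    (hlt : ∃ p ∈ f.support, w p = 0 ∨ totalDegree (φ p) < totalDegree p)
    (hne : ∃ p ∈ f.support, w p ≠ 0) :
    ∑ p ∈ f.support, Finsupp.single (φ p) (w p) ≠ 0 ∧
      supportSize (∑ p ∈ f.support, Finsupp.single (φ p) (w p)) < supportSize f := by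
  classical
  constructor
  · obtain ⟨p, hp, hwp⟩ := hne
    intro h0
    have h1 := DFunLike.congr_fun h0 (φ p)
    rw [Finsupp.finsetSum_apply, Finset.sum_eq_single p] at h1
    · simp [hwp] at h1
    · intro q _ hqp
      by_cases hwq : w q = 0
      · simp [hwq]
      · exact Finsupp.single_eq_of_ne fun hφ => hqp (hinj p q hwp hwq hφ).symm
    · exact fun hp' => absurd hp hp'
  · have hsub : (∑ p ∈ f.support, Finsupp.single (φ p) (w p)).support ⊆
        (f.support.filter fun p => w p ≠ 0).image φ := by
      intro r hr
      rw [Finsupp.mem_support_iff, Finsupp.finsetSum_apply] at hr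
      obtain ⟨p, hp, hpr⟩ := Finset.exists_ne_zero_of_sum_ne_zero hr
      rw [Finsupp.single_apply_ne_zero] at hpr
      exact Finset.mem_image.2 ⟨p, Finset.mem_filter.2 ⟨hp, hpr.2⟩, hpr.1.symm⟩
    calc supportSize (∑ p ∈ f.support, Finsupp.single (φ p) (w p))
        ≤ ∑ r ∈ (f.support.filter fun p => w p ≠ 0).image φ, (1 + totalDegree r) :=
          Finset.sum_le_sum_of_subset hsub
      _ = ∑ p ∈ f.support.filter fun p => w p ≠ 0, (1 + totalDegree (φ p)) := by
          rw [Finset.sum_image]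
          intro p hp q hq
          exact hinj p q (Finset.mem_filter.1 hp).2 (Finset.mem_filter.1 hq).2
      _ = ∑ p ∈ f.support, if w p ≠ 0 then 1 + totalDegree (φ p) else 0 := Finset.sum_filter _ _
      _ < supportSize f := by
          refine Finset.sum_lt_sum (fun p hp => ?_) ?_
          · split_ifs with hw
            · exact Nat.add_le_add_left (hle p hp hw) 1
            · exact Nat.zero_le _
          · obtain ⟨p, hp, hpw⟩ := hlt
            refine ⟨p, hp, ?_⟩
            split_ifs with hw
            · exact Nat.add_lt_add_left (hpw.resolve_left hw) 1
            · omega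

/-- In characteristic `0` equal weights in `K` are equal integers, and the twist is multiplicative
in the exponent. All terms of a weight-homogeneous element therefore share one skew scalar. -/
theorem twist_eq_of_sub_eq [CharZero K] (i : Fin n) {p q : (Fin n → ℕ) × (Fin n → ℕ)}
    (hpq : ∀ k, (p.1 k : K) - p.2 k = q.1 k - q.2 k) :
    Q.twist i p.1 * (Q.twist i p.2)⁻¹ = Q.twist i q.1 * (Q.twist i q.2)⁻¹ := by
  have h : p.1 + q.2 = q.1 + p.2 := by
    ext k
    have := hpq k
    rw [sub_eq_sub_iff_add_eq_add] at this
    exact_mod_cast this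
  rw [mul_inv_eq_iff_eq_mul, mul_right_comm, eq_mul_inv_iff_mul_eq, ← Q.twist_add, h, Q.twist_add]

theorem _root_.single_one_le {I : Fin n → ℕ} {i : Fin n} (h : I i ≠ 0) : Pi.single i 1 ≤ I := by
  intro k
  rcases eq_or_ne k i with rfl | hk
  · simpa using Nat.one_le_iff_ne_zero.2 h
  · simp [hk]

theorem _root_.totalDegree_sub_lt {p e : (Fin n → ℕ) × (Fin n → ℕ)} (he : e ≤ p)
    (h0 : 0 < totalDegree e) : totalDegree (p - e) < totalDegree p := by
  have := totalDegree_add (p - e) e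
  rw [tsub_add_cancel_of_le he] at this
  omega

/-- Descent on `supportSize`. Each case applies an operator that preserves the ideal and acts on
monomials by scaling or lowering exponents, removing or lowering at least one term while keeping
another nonzero or lowered one. -/
theorem one_mem_of_mem [CharZero K] (h : IsWeylSystem Q u v)
    (hb : ∀ p, b p = weylMonomial u v p) (I : TwoSidedIdeal A) (m : ℕ) :
    ∀ f ∈ I, f ≠ 0 → supportSize (b.repr f) = m → (1 : A) ∈ I := by
  induction m using Nat.strong_induction_on with
  | _ m ih =>
  intro f hf hf0 hm
  have hsmul : ∀ (c : K) (a : A), a ∈ I → c • a ∈ I := fun c a ha => by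
    rw [Algebra.smul_def]
    exact I.mul_mem_left _ _ ha
  have hsum : f = ∑ p ∈ (b.repr f).support, b.repr f p • b p := by
    conv_lhs => rw [← b.linearCombination_repr f, Finsupp.linearCombination_apply, Finsupp.sum]
  -- If `T f` lies in the ideal and is a sum of terms as in `supportSize_lt`, then `T f` is smaller.
  have step : ∀ (T : A →ₗ[K] A) (φ : _ → (Fin n → ℕ) × (Fin n → ℕ)) (w : _ → K), T f ∈ I →
      (∀ p ∈ (b.repr f).support, T (b p) = w p • b (φ p)) →
      (∀ p q, w p ≠ 0 → w q ≠ 0 → φ p = φ q → p = q) →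
      (∀ p ∈ (b.repr f).support, w p ≠ 0 → totalDegree (φ p) ≤ totalDegree p) →
      (∃ p ∈ (b.repr f).support, w p = 0 ∨ totalDegree (φ p) < totalDegree p) →
      (∃ p ∈ (b.repr f).support, w p ≠ 0) → (1 : A) ∈ I := by
    intro T φ w hT hTb hinj hle hlt hne
    have hmem : ∀ p ∈ (b.repr f).support, b.repr f p ≠ 0 := fun p hp =>
      Finsupp.mem_support_iff.1 hp
    have hrepr : b.repr (T f) =
        ∑ p ∈ (b.repr f).support, Finsupp.single (φ p) (b.repr f p * w p) := by
      conv_lhs => rw [hsum]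
      rw [map_sum, map_sum]
      refine Finset.sum_congr rfl fun p hp => ?_
      rw [map_smul, hTb p hp, smul_smul, map_smul, b.repr_self, Finsupp.smul_single_one]
    obtain ⟨p₁, hp₁, hlt₁⟩ := hlt
    obtain ⟨p₂, hp₂, hne₂⟩ := hne
    have key := supportSize_lt (f := b.repr f) (φ := φ) (w := fun p => b.repr f p * w p)
      (fun p q hp hq => hinj p q (right_ne_zero_of_mul hp) (right_ne_zero_of_mul hq))
      (fun p hp hw => hle p hp (right_ne_zero_of_mul hw))
      ⟨p₁, hp₁, hlt₁.imp_left fun hw => by simp [hw]⟩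
      ⟨p₂, hp₂, mul_ne_zero (hmem p₂ hp₂) hne₂⟩
    rw [← hrepr] at key
    exact ih _ (hm ▸ key.2) (T f) hT (fun hT0 => key.1 (by rw [hT0, map_zero])) rfl
  by_cases hhom : ∀ p ∈ (b.repr f).support, ∀ q ∈ (b.repr f).support, ∀ k,
      (p.1 k : K) - p.2 k = q.1 k - q.2 k
  swap
  · push Not at hhom
    obtain ⟨p, hp, q, hq, i, hpq⟩ := hhom
    -- Subtracting the weight of `p` kills the term at `p`, while the term at `q`, of different
    -- weight, survives.
    refine step (LinearMap.mulLeft K (v i * u i) - LinearMap.mulRight K (v i * u i) -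
      ((p.1 i : K) - p.2 i) • LinearMap.id) id
      (fun r => ((r.1 i : K) - r.2 i) - ((p.1 i : K) - p.2 i)) ?_ ?_ ?_ ?_ ?_ ?_
    · exact I.sub_mem (I.sub_mem (I.mul_mem_left _ _ hf) (I.mul_mem_right _ _ hf)) (hsmul _ _ hf)
    · intro r _
      simp only [LinearMap.sub_apply, LinearMap.mulLeft_apply, LinearMap.mulRight_apply,
        LinearMap.smul_apply, LinearMap.id_apply, hb, h.vu_mul_weylMonomial, id, sub_smul]
      abel
    · exact fun _ _ _ _ h => h
    · exact fun _ _ _ => le_rfl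
    · exact ⟨p, hp, Or.inl (sub_self _)⟩
    · exact ⟨q, hq, sub_ne_zero.2 hpq.symm⟩
  by_cases h1 : ∃ p ∈ (b.repr f).support, ∃ i, p.1 i ≠ 0
  · obtain ⟨p, hp, i, hpi⟩ := h1
    choose d hd using h.u_mul_weylMonomial_comm i
    -- A nonzero coefficient forces `r.1 i ≠ 0`, so the subtraction of exponents is genuine and
    -- injective on these terms.
    have hwi : ∀ r : (Fin n → ℕ) × (Fin n → ℕ), (r.1 i * d r : K) ≠ 0 →
        ((Pi.single i 1, 0) : (Fin n → ℕ) × (Fin n → ℕ)) ≤ r := fun r hr =>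
      Prod.mk_le_mk.2 ⟨single_one_le fun h0 => hr (by simp [h0]),
        zero_le⟩
    have he : 0 < totalDegree ((Pi.single i 1, 0) : (Fin n → ℕ) × (Fin n → ℕ)) := by
      simp [totalDegree]
    have hwp : (p.1 i * d p : K) ≠ 0 := mul_ne_zero (Nat.cast_ne_zero.2 hpi) (d p).ne_zero
    -- The skew scalar of `p` serves for every term by homogeneity; only the derivative terms
    -- remain.
    refine step (LinearMap.mulLeft K (u i) -
      ((Q.twist i p.1 * (Q.twist i p.2)⁻¹ : Kˣ) : K) • LinearMap.mulRight K (u i))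
      (fun r => r - (Pi.single i 1, 0)) (fun r => r.1 i * d r) ?_ ?_ ?_ ?_ ?_ ?_
    · exact I.sub_mem (I.mul_mem_left _ _ hf) (hsmul _ _ (I.mul_mem_right _ _ hf))
    · intro r hr
      rw [LinearMap.sub_apply, LinearMap.smul_apply, LinearMap.mulLeft_apply,
        LinearMap.mulRight_apply, hb, hd r, twist_eq_of_sub_eq i (hhom r hr p hp),
        add_sub_cancel_left, hb]
    · intro r s hr hs hrs
      rw [← tsub_add_cancel_of_le (hwi r hr), ← tsub_add_cancel_of_le (hwi s hs), hrs]
    · exact fun r _ hr => (totalDegree_sub_lt (hwi r hr) he).le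
    · exact ⟨p, hp, Or.inr (totalDegree_sub_lt (hwi p hwp) he)⟩
    · exact ⟨p, hp, hwp⟩
  by_cases h2 : ∃ p ∈ (b.repr f).support, ∃ i, p.2 i ≠ 0
  · obtain ⟨p, hp, i, hpi⟩ := h2
    choose d hd using h.weylMonomial_mul_v_comm i
    have hwi : ∀ r : (Fin n → ℕ) × (Fin n → ℕ), (r.2 i * d r : K) ≠ 0 →
        ((0, Pi.single i 1) : (Fin n → ℕ) × (Fin n → ℕ)) ≤ r := fun r hr =>
      Prod.mk_le_mk.2 ⟨zero_le,
        single_one_le fun h0 => hr (by simp [h0])⟩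
    have he : 0 < totalDegree ((0, Pi.single i 1) : (Fin n → ℕ) × (Fin n → ℕ)) := by
      simp [totalDegree]
    have hwp : (p.2 i * d p : K) ≠ 0 := mul_ne_zero (Nat.cast_ne_zero.2 hpi) (d p).ne_zero
    refine step (LinearMap.mulRight K (v i) -
      ((Q.twist i p.1 * (Q.twist i p.2)⁻¹ : Kˣ) : K) • LinearMap.mulLeft K (v i))
      (fun r => r - (0, Pi.single i 1)) (fun r => r.2 i * d r) ?_ ?_ ?_ ?_ ?_ ?_
    · exact I.sub_mem (I.mul_mem_right _ _ hf) (hsmul _ _ (I.mul_mem_left _ _ hf))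
    · intro r hr
      rw [LinearMap.sub_apply, LinearMap.smul_apply, LinearMap.mulLeft_apply,
        LinearMap.mulRight_apply, hb, hd r, twist_eq_of_sub_eq i (hhom r hr p hp),
        add_sub_cancel_left, hb]
    · intro r s hr hs hrs
      rw [← tsub_add_cancel_of_le (hwi r hr), ← tsub_add_cancel_of_le (hwi s hs), hrs]
    · exact fun r _ hr => (totalDegree_sub_lt (hwi r hr) he).le
    · exact ⟨p, hp, Or.inr (totalDegree_sub_lt (hwi p hwp) he)⟩
    · exact ⟨p, hp, hwp⟩
  push Not at h1 h2
  -- No generator is left in any term, so `f` is a nonzero scalar.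
  have hsupp : (b.repr f).support ⊆ {0} := fun p hp =>
    Finset.mem_singleton.2 (Prod.ext (funext (h1 p hp)) (funext (h2 p hp)))
  have hf1 : f = b.repr f 0 • (1 : A) := by
    have hb0 : b 0 = 1 := by simp [hb, weylMonomial]
    conv_lhs => rw [hsum]
    rw [Finset.sum_subset hsupp, Finset.sum_singleton, hb0]
    intro p _ hp
    rw [Finsupp.notMem_support_iff.1 hp, zero_smul]
  have hc : b.repr f 0 ≠ 0 := fun h0 => hf0 (by rw [hf1, h0, zero_smul])
  have h1' : (1 : A) = (b.repr f 0)⁻¹ • f := by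
    rw [eq_inv_smul_iff₀ hc]
    exact hf1.symm
  rw [h1']
  exact hsmul _ _ hf

theorem isSimpleRing [CharZero K] [Nontrivial A] (h : IsWeylSystem Q u v)
    (hb : ∀ p, b p = weylMonomial u v p) : IsSimpleRing A where
  simple :=
    { eq_bot_or_eq_top := fun I => by
        by_cases hI : ∃ f ∈ I, f ≠ 0
        · obtain ⟨f, hf, hf0⟩ := hI
          exact Or.inr ((I.one_mem_iff).1 (h.one_mem_of_mem hb I _ f hf hf0 rfl))
        · push Not at hI
          refine Or.inl (le_bot_iff.1 fun f hf => ?_)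
          rw [hI f hf]
          exact zero_mem _ }

end IsWeylSystem

end WeylRing

section WeylGrowth

variable {K A : Type*} [Field K] [Ring A] [Algebra K A] {n : ℕ}

namespace IsWeylSystem

variable {Q : QuantumMatrix K n} {u v : Fin n → A}

/-! #### Gelfand–Kirillov dimension -/

/-- The span of the monomials all of whose exponents are at most `N`. -/
def _root_.weylBox (K : Type*) {A : Type*} [Field K] [Ring A] [Algebra K A] {n : ℕ}
    (u v : Fin n → A) (N : ℕ) : Submodule K A :=
  Submodule.span K (weylMonomial u v '' Set.Iic (fun _ => N, fun _ => N))

theorem _root_.weylBox_mono {M N : ℕ} (h : M ≤ N) : weylBox K u v M ≤ weylBox K u v N :=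
  Submodule.span_mono (Set.image_mono (Set.Iic_subset_Iic.2 ⟨fun _ => h, fun _ => h⟩))

theorem weylBox_mul_le (h : IsWeylSystem Q u v) (M N : ℕ) :
    weylBox K u v M * weylBox K u v N ≤ weylBox K u v (M + N) := by
  rw [weylBox, weylBox, Submodule.span_mul_span, Submodule.span_le]
  rintro _ ⟨_, ⟨p, hp, rfl⟩, _, ⟨q, hq, rfl⟩, rfl⟩
  refine Submodule.span_mono (Set.image_mono (Set.Iic_subset_Iic.2 ?_))
    (h.hasWeylLead_mul p q).mem_span
  exact add_le_add (Set.mem_Iic.1 hp) (Set.mem_Iic.1 hq)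

theorem weylBox_pow_le (h : IsWeylSystem Q u v) (N m : ℕ) :
    weylBox K u v N ^ m ≤ weylBox K u v (N * m) := by
  induction m with
  | zero =>
    rw [pow_zero, Submodule.one_le]
    exact Submodule.subset_span ⟨0, ⟨fun _ => Nat.zero_le _, fun _ => Nat.zero_le _⟩,
      by simp [weylMonomial]⟩
  | succ m ih =>
    rw [pow_succ, Nat.mul_succ]
    exact (mul_le_mul_left ih _).trans (h.weylBox_mul_le _ _)

/-- The exponents with all entries at most `N`. -/
def _root_.exponentBox (n N : ℕ) : Finset ((Fin n → ℕ) × (Fin n → ℕ)) :=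
  Fintype.piFinset (fun _ => Finset.range (N + 1)) ×ˢ
    Fintype.piFinset (fun _ => Finset.range (N + 1))

theorem _root_.coe_exponentBox (n N : ℕ) :
    (exponentBox n N : Set ((Fin n → ℕ) × (Fin n → ℕ))) = Set.Iic (fun _ => N, fun _ => N) := by
  ext p
  simp [exponentBox, Prod.le_def, Pi.le_def]

theorem _root_.finrank_weylBox (hli : LinearIndependent K (weylMonomial u v)) (N : ℕ) :
    Module.finrank K (weylBox K u v N) = (N + 1) ^ (2 * n) := by
  rw [weylBox, ← coe_exponentBox, Set.image_eq_range]
  refine (finrank_span_eq_card (hli.comp _ Subtype.val_injective)).trans ?_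
  refine (Fintype.card_coe (exponentBox n N)).trans ?_
  simp [exponentBox, two_mul, pow_add]

instance _root_.finiteDimensional_weylBox (N : ℕ) : FiniteDimensional K (weylBox K u v N) := by
  rw [weylBox, ← coe_exponentBox]
  exact FiniteDimensional.span_of_finite K ((Finset.finite_toSet _).image _)

theorem _root_.exists_le_weylBox (hspan : Submodule.span K (Set.range (weylMonomial u v)) = ⊤)
    (V : Submodule K A) [FiniteDimensional K V] : ∃ N, V ≤ weylBox K u v N := by
  have hmem : ∀ a : A, ∃ N, a ∈ weylBox K u v N := by
    intro a
    have ha : a ∈ Submodule.span K (Set.range (weylMonomial u v)) := hspan ▸ Submodule.mem_top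
    induction ha using Submodule.span_induction with
    | mem a ha =>
      obtain ⟨p, rfl⟩ := ha
      refine ⟨totalDegree p, Submodule.subset_span ⟨p, ⟨fun k => ?_, fun k => ?_⟩, rfl⟩⟩
      · exact (Finset.single_le_sum (f := p.1) (fun _ _ => Nat.zero_le _)
          (Finset.mem_univ k)).trans (Nat.le_add_right _ _)
      · exact (Finset.single_le_sum (f := p.2) (fun _ _ => Nat.zero_le _)
          (Finset.mem_univ k)).trans (Nat.le_add_left _ _)
    | zero => exact ⟨0, zero_mem _⟩
    | add a a' _ _ iha iha' =>
      obtain ⟨N, hN⟩ := iha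
      obtain ⟨N', hN'⟩ := iha'
      exact ⟨max N N', add_mem (weylBox_mono (le_max_left _ _) hN)
        (weylBox_mono (le_max_right _ _) hN')⟩
    | smul c a _ iha =>
      obtain ⟨N, hN⟩ := iha
      exact ⟨N, Submodule.smul_mem _ _ hN⟩
  choose N hN using hmem
  obtain ⟨s, hs⟩ : V.FG := (Submodule.fg_top V).1 Module.Finite.fg_top
  refine ⟨s.sup N, ?_⟩
  rw [← hs, Submodule.span_le]
  exact fun a ha => weylBox_mono (Finset.le_sup ha) (hN a)

/-- A monomial in the box is a word of length at most `2 * n * N`, and the powers of `V` increase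
because `1 ∈ V`. -/
theorem _root_.weylBox_le_pow (V : Submodule K A) (h1 : 1 ∈ V) (hu : ∀ i, u i ∈ V)
    (hv : ∀ i, v i ∈ V) (N : ℕ) : weylBox K u v N ≤ V ^ (2 * n * N) := by
  have hmono : Monotone fun m : ℕ => V ^ m := fun a b hab =>
    pow_le_pow_right' (Submodule.one_le.2 h1) hab
  have hmem : ∀ x : Fin n → A, (∀ i, x i ∈ V) → ∀ I : Fin n → ℕ, ordMonomial x I ∈ V ^ ∑ k, I k :=
    fun x hx I => by
      have := ordMonomial_induction (P := fun a m => a ∈ V ^ m)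
        (by rw [pow_zero]; exact Submodule.one_le.1 le_rfl)
        (fun a b d e ha hb => by
          rw [pow_add]
          exact Submodule.mul_mem_mul ha hb) x (fun _ => 1) (fun k => by simpa using hx k) I
      simpa using this
  rw [weylBox, Submodule.span_le]
  rintro _ ⟨p, hp, rfl⟩
  have hle : ∀ I : Fin n → ℕ, (I ≤ fun _ => N) → ∑ k, I k ≤ n * N := fun I hI =>
    (Finset.sum_le_sum fun k _ => hI k).trans (by simp)
  refine hmono (a := ∑ k, p.1 k + ∑ k, p.2 k) ?_ ?_
  · have := hle _ hp.1
    have := hle _ hp.2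
    linarith
  · change weylMonomial u v p ∈ V ^ (_ + _)
    rw [pow_add]
    exact Submodule.mul_mem_mul (hmem v hv p.1) (hmem u hu p.2)

theorem _root_.tendsto_mul_log_add_div_log (N c : ℝ) :
    Tendsto (fun m : ℕ => ((N * (Real.log m + c) / Real.log m : ℝ) : EReal)) atTop
      (nhds ((N : ℝ) : EReal)) := by
  rw [EReal.tendsto_coe]
  have hlog : Tendsto (fun m : ℕ => Real.log m) atTop atTop :=
    Real.tendsto_log_atTop.comp tendsto_natCast_atTop_atTop
  have h : Tendsto (fun m : ℕ => N * (1 + c / Real.log m)) atTop (nhds (N * (1 + 0))) :=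
    (tendsto_const_nhds.add (hlog.const_div_atTop c)).const_mul N
  rw [add_zero, mul_one] at h
  refine h.congr' ?_
  filter_upwards [hlog.eventually_gt_atTop 0] with m hm
  field_simp

/-- A subspace inside the box of size `N` has its `m`-th power inside the box of size `N * m`;
conversely, the `m`-th power of the span of `1` and the generators contains a box of size
proportional to `m`. Both bounds have the shape `2n (log m + c) / log m`, and the constant `c`
disappears in the limit. -/
theorem gkDim_eq (h : IsWeylSystem Q u v)
    (hli : LinearIndependent K (weylMonomial u v))
    (hspan : Submodule.span K (Set.range (weylMonomial u v)) = ⊤) :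
    gkDim K A = ((2 * n : ℕ) : EReal) := by
  have hcast : ((2 * n : ℕ) : EReal) = (((2 * n : ℕ) : ℝ) : EReal) :=
    EReal.coe_natCast.symm
  rw [hcast]
  refine le_antisymm ?_ ?_
  · refine iSup₂_le fun V hV => iSup_le fun _ => ?_
    obtain ⟨N, hN⟩ := exists_le_weylBox hspan V
    rw [← (tendsto_mul_log_add_div_log ((2 * n : ℕ) : ℝ) (Real.log (N + 1))).limsup_eq]
    refine limsup_le_limsup ?_
    filter_upwards [eventually_ge_atTop 2] with m hm
    rw [EReal.coe_le_coe_iff]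
    have hm0 : (0 : ℝ) < m := by positivity
    have hfin : Module.finrank K ↥(V ^ m) ≤ ((N + 1) * m) ^ (2 * n) := by
      calc Module.finrank K ↥(V ^ m) ≤ Module.finrank K (weylBox K u v (N * m)) :=
            Submodule.finrank_mono ((pow_le_pow_left' hN m).trans (h.weylBox_pow_le N m))
        _ = (N * m + 1) ^ (2 * n) := finrank_weylBox hli _
        _ ≤ ((N + 1) * m) ^ (2 * n) := Nat.pow_le_pow_left (by nlinarith) _
    refine div_le_div_of_nonneg_right ?_ (Real.log_nonneg (by exact_mod_cast by omega))
    -- Monotonicity of the logarithm needs a positive argument; in dimension `0` the convention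
    -- `Real.log 0 = 0` leaves only a sign to check.
    rcases Nat.eq_zero_or_pos (Module.finrank K ↥(V ^ m)) with h0 | h0
    · rw [h0, Nat.cast_zero, Real.log_zero]
      have : 0 ≤ Real.log (m : ℝ) := Real.log_nonneg (by exact_mod_cast by omega)
      have : 0 ≤ Real.log ((N : ℝ) + 1) := Real.log_nonneg (by simp)
      positivity
    · calc Real.log (Module.finrank K ↥(V ^ m) : ℝ)
          ≤ Real.log ((((N + 1) * m) ^ (2 * n) : ℕ) : ℝ) :=
            Real.log_le_log (by exact_mod_cast h0) (by exact_mod_cast hfin)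
        _ = _ := by
            push_cast
            rw [Real.log_pow, Real.log_mul (by positivity) hm0.ne', add_comm]
            push_cast
            ring
  · let V : Submodule K A := Submodule.span K ({1} ∪ (Set.range u ∪ Set.range v))
    have hVfin : FiniteDimensional K V := FiniteDimensional.span_of_finite K
      ((Set.finite_singleton _).union ((Set.finite_range u).union (Set.finite_range v)))
    have hV1 : (1 : A) ∈ V := Submodule.subset_span (Or.inl rfl)
    refine le_trans ?_ (le_iSup₂_of_le V hVfin (le_iSup_of_le hV1 le_rfl))
    rw [← (tendsto_mul_log_add_div_log ((2 * n : ℕ) : ℝ) (-Real.log (2 * n + 1))).limsup_eq]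
    refine limsup_le_limsup ?_
    filter_upwards [eventually_ge_atTop 2] with m hm
    rw [EReal.coe_le_coe_iff]
    have hm0 : (0 : ℝ) < m := by positivity
    -- Rounded division: a box of size `m / (2n + 1)` needs words of length at most `m`. The divisor
    -- `2n + 1` is positive for every `n`.
    have hfin : (m / (2 * n + 1) + 1) ^ (2 * n) ≤ Module.finrank K ↥(V ^ m) := by
      rw [← finrank_weylBox hli]
      have : FiniteDimensional K ↥(V ^ m) := Module.Finite.iff_fg.2
        ((Module.Finite.iff_fg.1 hVfin).pow m)
      refine Submodule.finrank_mono ((weylBox_le_pow V hV1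
        (fun i => Submodule.subset_span (Or.inr (Or.inl ⟨i, rfl⟩)))
        (fun i => Submodule.subset_span (Or.inr (Or.inr ⟨i, rfl⟩))) _).trans
        (pow_le_pow_right' (Submodule.one_le.2 hV1) ?_))
      calc 2 * n * (m / (2 * n + 1)) ≤ (2 * n + 1) * (m / (2 * n + 1)) :=
            Nat.mul_le_mul_right _ (Nat.le_succ _)
        _ ≤ m := Nat.mul_div_le _ _
    have hdiv : (m : ℝ) / (2 * n + 1) ≤ ((m / (2 * n + 1) + 1 : ℕ) : ℝ) := by
      rw [div_le_iff₀ (by positivity)]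
      have := (Nat.lt_div_mul_add (a := m) (b := 2 * n + 1) (by omega)).le
      have h' : m ≤ (m / (2 * n + 1) + 1) * (2 * n + 1) := by linarith
      exact_mod_cast h'
    refine div_le_div_of_nonneg_right ?_ (Real.log_nonneg (by exact_mod_cast by omega))
    rw [← sub_eq_add_neg, ← Real.log_div hm0.ne' (by positivity), ← Real.log_pow]
    refine Real.log_le_log (by positivity) ?_
    calc ((m : ℝ) / (2 * n + 1)) ^ (2 * n) ≤ ((m / (2 * n + 1) + 1 : ℕ) : ℝ) ^ (2 * n) :=
          pow_le_pow_left₀ (by positivity) hdiv _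
      _ ≤ _ := by exact_mod_cast hfin

end IsWeylSystem

end WeylGrowth

/-! ### The algebra generated by the `ρ_{x_i}` and the `δ_i` -/

namespace QuantumSpace

variable {K : Type*} [Field K] {n : ℕ} (Q : QuantumMatrix K n)

instance : Nontrivial (QuantumSpace Q) := by
  let f : QuantumSpace Q →ₐ[K] K := lift Q (fun _ => 0) (by simp)
  exact f.toRingHom.domain_nontrivial

/-- A subspace that contains `1` and is stable under the `ρ_{x_k}` is everything. -/
theorem eq_top_of_rho_mem (N : Submodule K (QuantumSpace Q)) (h1 : 1 ∈ N)
    (h : ∀ k, ∀ r ∈ N, rho Q k r ∈ N) : N = ⊤ := by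
  have key : ∀ s : FreeAlgebra K (Fin n), ∀ r ∈ N, r * mk Q s ∈ N := by
    intro s
    induction s using FreeAlgebra.induction with
    | grade0 c =>
      intro r hr
      rw [AlgHom.commutes, ← Algebra.commutes, ← Algebra.smul_def]
      exact N.smul_mem _ hr
    | grade1 k => exact h k
    | mul s t hs ht =>
      intro r hr
      rw [map_mul, ← mul_assoc]
      exact ht _ (hs _ hr)
    | add s t hs ht =>
      intro r hr
      rw [map_add, mul_add]
      exact add_mem (hs _ hr) (ht _ hr)
  rw [eq_top_iff]
  intro s _
  obtain ⟨s, rfl⟩ := mk_surjective Q s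
  simpa using key s 1 h1

/-! ### The Weyl relations for the operators on `R_n`. -/

theorem delta_one (i : Fin n) : delta Q i 1 = 0 := by
  simp [delta]

theorem sigma_x (a : Fin n → ℤ) (j : Fin n) :
    sigma Q a (x Q j) = (bichar Q a (Pi.single j 1) : K) • x Q j := by
  simp [sigma]

/-- Right multiplication reverses products, which is why the transposed parameters appear. -/
theorem rho_mul_rho (i j : Fin n) : rho Q i * rho Q j = (Q.entry j i : K) • (rho Q j * rho Q i) := by
  ext r
  simp [rho, mul_assoc, x_mul_x Q j i]

theorem delta_mul_rho (i j : Fin n) :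
    delta Q i * rho Q j = (Q.entry i j : K) • (rho Q j * delta Q i) + if j = i then 1 else 0 := by
  ext r
  simp only [rho, Module.End.mul_apply, LinearMap.mulRight_apply, delta_mul, sigma_x, bichar_single,
    delta_x, mul_smul_comm, LinearMap.add_apply, LinearMap.smul_apply]
  split_ifs <;> simp

/-- The inhomogeneous terms cancel by `q_ij q_ji = 1`, so the difference of the two sides
skew-commutes with every `ρ_{x_k}`. Its kernel contains `1` and is stable under the `ρ_{x_k}`, hence
is everything. -/
theorem delta_mul_delta (i j : Fin n) :
    delta Q i * delta Q j = (Q.entry j i : K) • (delta Q j * delta Q i) := by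
  have hq : ∀ k l, (Q.entry k l : K) * (Q.entry l k : K) = 1 := fun k l => by
    rw [← Units.val_mul, Q.antisymm, Units.val_one]
  have hcomm : ∀ k, (delta Q i * delta Q j - (Q.entry j i : K) • (delta Q j * delta Q i)) *
      rho Q k = ((Q.entry j k : K) * Q.entry i k) • (rho Q k *
        (delta Q i * delta Q j - (Q.entry j i : K) • (delta Q j * delta Q i))) := by
    intro k
    have h1 : delta Q i * delta Q j * rho Q k =
        ((Q.entry j k : K) * Q.entry i k) • (rho Q k * (delta Q i * delta Q j)) +
          (if k = i then (Q.entry j i : K) • delta Q j else 0) +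
          (if k = j then delta Q i else 0) := by
      rw [mul_assoc, delta_mul_rho, mul_add, mul_smul_comm, ← mul_assoc, delta_mul_rho, add_mul,
        smul_add, smul_mul_assoc, smul_smul, mul_assoc]
      congr 1
      · congr 1
        split_ifs with hk
        · rw [one_mul, hk]
        · simp
      · split_ifs <;> simp
    have h2 : delta Q j * delta Q i * rho Q k =
        ((Q.entry i k : K) * Q.entry j k) • (rho Q k * (delta Q j * delta Q i)) +
          (if k = j then (Q.entry i j : K) • delta Q i else 0) +
          (if k = i then delta Q j else 0) := by
      rw [mul_assoc, delta_mul_rho, mul_add, mul_smul_comm, ← mul_assoc, delta_mul_rho, add_mul,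
        smul_add, smul_mul_assoc, smul_smul, mul_assoc]
      congr 1
      · congr 1
        split_ifs with hk
        · rw [one_mul, hk]
        · simp
      · split_ifs <;> simp
    rw [sub_mul, smul_mul_assoc, h1, h2, mul_sub, smul_sub, mul_smul_comm, smul_add, smul_add]
    simp only [smul_ite, smul_smul, hq, one_smul, smul_zero]
    rw [mul_comm (Q.entry i k : K), mul_comm (Q.entry j i : K)]
    abel
  have hker : LinearMap.ker
      (delta Q i * delta Q j - (Q.entry j i : K) • (delta Q j * delta Q i)) = ⊤ := by
    refine eq_top_of_rho_mem Q _ ?_ ?_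
    · simp [delta_one]
    · intro k r hr
      rw [LinearMap.mem_ker] at hr ⊢
      rw [← Module.End.mul_apply, hcomm, LinearMap.smul_apply, Module.End.mul_apply, hr, map_zero,
        smul_zero]
  exact sub_eq_zero.1 (LinearMap.ker_eq_top.1 hker)

theorem isWeylSystem_end : IsWeylSystem Q (delta Q) (rho Q) :=
  ⟨rho_mul_rho Q, delta_mul_delta Q, delta_mul_rho Q⟩

/-! #### Linear independence of the monomials -/

/-- The element `ρ_I 1` of `R_n`, a monomial in the `x_i`. -/
def rhoOne (I : Fin n → ℕ) : QuantumSpace Q := ordMonomial (rho Q) I 1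

theorem rhoOne_mem_grading (I : Fin n → ℕ) : rhoOne Q I ∈ grading Q fun k => (I k : ℤ) := by
  have h := ordMonomial_induction
    (P := fun (g : Module.End K (QuantumSpace Q)) (e : Fin n → ℤ) =>
      ∀ d, ∀ r ∈ grading Q d, g r ∈ grading Q (d + e)) (by simp)
    (fun a b d e ha hb c r hr => by
      rw [Module.End.mul_apply, add_comm d, ← add_assoc]
      exact ha _ _ (hb _ _ hr)) (rho Q) (fun k => Pi.single k 1)
    (fun k d r hr => SetLike.mul_mem_graded hr (x_mem_grading Q k)) I 0 1 SetLike.GradedOne.one_mem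
  have hI : ∑ k, I k • (Pi.single k 1 : Fin n → ℤ) = fun k => (I k : ℤ) := by
    ext j
    simp [Finset.sum_apply, Pi.single_apply]
  rwa [zero_add, hI] at h

/-- Since `δ_k 1 = 0`, moving `δ_k` through `ρ_I` leaves only the Weyl remainder, whose coefficient
vanishes exactly when `I k = 0`. If `J ≤ I` fails, the truncated `I - J` is immaterial because `s =
0`. -/
theorem deltaMonomial_rhoOne [CharZero K] (I J : Fin n → ℕ) :
    ∃ s : K, ordMonomial (delta Q) J (rhoOne Q I) = s • rhoOne Q (I - J) ∧ (s ≠ 0 ↔ J ≤ I) := by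
  have h := ordMonomial_induction
    (P := fun (g : Module.End K (QuantumSpace Q)) (e : Fin n → ℕ) =>
      ∀ I, ∃ s : K, g (rhoOne Q I) = s • rhoOne Q (I - e) ∧ (s ≠ 0 ↔ e ≤ I))
    (fun I => ⟨1, by simp, by simp⟩)
    (fun a b d e ha hb I => by
      obtain ⟨s, hs, hs'⟩ := hb I
      obtain ⟨t, ht, ht'⟩ := ha (I - e)
      refine ⟨s * t, ?_, ?_⟩
      · rw [Module.End.mul_apply, hs, map_smul, ht, smul_smul, tsub_tsub, add_comm e]
      · rw [mul_ne_zero_iff, hs', ht']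
        constructor
        · rintro ⟨h1, h2⟩
          exact (le_tsub_iff_right h1).1 h2
        · intro h
          have h1 : e ≤ I := le_trans le_add_self h
          exact ⟨h1, (le_tsub_iff_right h1).2 h⟩)
    (delta Q) (fun k => Pi.single k 1)
    (fun k I => by
      obtain ⟨d, hd⟩ := mul_ordMonomial_of_weyl (Q.diag k) ((isWeylSystem_end Q).uv k) I
      refine ⟨I k * d, ?_, ?_⟩
      · rw [rhoOne, ← Module.End.mul_apply, hd, LinearMap.add_apply, LinearMap.smul_apply,
          Module.End.mul_apply, delta_one, map_zero, smul_zero, zero_add]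
        rfl
      · rw [mul_ne_zero_iff, Nat.cast_ne_zero]
        constructor
        · exact fun h => single_one_le h.1
        · intro h
          exact ⟨Nat.one_le_iff_ne_zero.1 (by simpa using h k), d.ne_zero⟩) J I
  rwa [sum_smul_single] at h

/-- Applying `δ_I` returns a nonzero multiple of `1`; no basis of `R_n` has to be known beforehand.
-/
theorem rhoOne_ne_zero [CharZero K] (I : Fin n → ℕ) : rhoOne Q I ≠ 0 := by
  intro h0
  obtain ⟨s, hs, hs'⟩ := deltaMonomial_rhoOne Q I I
  rw [h0, map_zero, tsub_self, rhoOne, ordMonomial_zero, Module.End.one_apply] at hs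
  exact smul_ne_zero (hs'.2 le_rfl) one_ne_zero hs.symm

theorem linearIndependent_rhoOne [CharZero K] : LinearIndependent K (rhoOne Q) := by
  have hind := (DirectSum.Decomposition.isInternal (grading Q)).submodule_iSupIndep
  have hinj : Function.Injective fun (I : Fin n → ℕ) (k : Fin n) => (I k : ℤ) := by
    intro I J h
    ext k
    exact Nat.cast_injective (R := ℤ) (congrFun h k)
  exact (hind.comp hinj).linearIndependent _ (rhoOne_mem_grading Q) (rhoOne_ne_zero Q)

/-- In a nontrivial relation take a term `ρ_I δ_J` with `J` minimal and evaluate at `ρ_J 1`. Terms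
with another `δ`-exponent vanish, the rest become multiples of the independent elements `ρ_I 1`. -/
theorem linearIndependent_weylMonomial [CharZero K] :
    LinearIndependent K (weylMonomial (delta Q) (rho Q)) := by
  classical
  rw [linearIndependent_iff]
  intro f hf
  by_contra hf0
  obtain ⟨p, hp, hmin⟩ := f.support.exists_minimalFor (fun p => p.2)
    (Finsupp.support_nonempty_iff.2 hf0)
  have h0 : ∑ q ∈ f.support, f q • weylMonomial (delta Q) (rho Q) q (rhoOne Q p.2) = 0 := by
    have := LinearMap.congr_fun hf (rhoOne Q p.2)
    simpa [Finsupp.linearCombination_apply, Finsupp.sum, LinearMap.sum_apply] using this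
  obtain ⟨s, hs, hs'⟩ := deltaMonomial_rhoOne Q p.2 p.2
  have hterm : ∀ q ∈ f.support, f q • weylMonomial (delta Q) (rho Q) q (rhoOne Q p.2) =
      (if q.2 = p.2 then f q * s else 0) • rhoOne Q q.1 := by
    intro q hq
    rw [weylMonomial_def, Module.End.mul_apply]
    split_ifs with hqp
    · rw [hqp, hs, tsub_self, map_smul, smul_smul]
      congr 1
      rw [rhoOne, ordMonomial_zero, Module.End.one_apply, rhoOne]
    · obtain ⟨t, ht, ht'⟩ := deltaMonomial_rhoOne Q p.2 q.2
      have hle : ¬ q.2 ≤ p.2 := fun hle => hqp (le_antisymm hle (hmin hq hle))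
      rw [← ht', not_not] at hle
      rw [ht, hle, zero_smul, map_zero, smul_zero, zero_smul]
  rw [Finset.sum_congr rfl hterm] at h0
  have hli := linearIndependent_iff.1 (linearIndependent_rhoOne Q)
    (∑ q ∈ f.support, Finsupp.single q.1 (if q.2 = p.2 then f q * s else 0))
    (by rw [map_sum]; simpa only [Finsupp.linearCombination_single] using h0)
  have hcoef := DFunLike.congr_fun hli p.1
  rw [Finsupp.finsetSum_apply, Finset.sum_eq_single p] at hcoef
  · rw [if_pos rfl, Finsupp.single_eq_same, Finsupp.zero_apply, mul_eq_zero] at hcoef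
    exact hcoef.elim (Finsupp.mem_support_iff.1 hp) (hs'.2 le_rfl)
  · intro q _ hqp
    by_cases h2 : q.2 = p.2
    · exact Finsupp.single_eq_of_ne fun h1 => hqp (Prod.ext h1.symm h2)
    · rw [if_neg h2, Finsupp.single_zero, Finsupp.zero_apply]
  · exact fun h => absurd hp h

/-! #### The Weyl system in `Δ` -/

/-- `δ_i` as an element of `Δ`. -/
def deltaD (i : Fin n) : Delta Q := ⟨delta Q i, Algebra.subset_adjoin (Or.inr ⟨i, rfl⟩)⟩

/-- `ρ_{x_i}` as an element of `Δ`. -/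
def rhoD (i : Fin n) : Delta Q := ⟨rho Q i, Algebra.subset_adjoin (Or.inl ⟨i, rfl⟩)⟩

theorem isWeylSystem_delta : IsWeylSystem Q (deltaD Q) (rhoD Q) where
  vv i j := Subtype.ext (rho_mul_rho Q i j)
  uu i j := Subtype.ext (delta_mul_delta Q i j)
  uv i j := Subtype.ext (by
    refine (delta_mul_rho Q i j).trans ?_
    split_ifs <;> rfl)

theorem coe_weylMonomial (p : (Fin n → ℕ) × (Fin n → ℕ)) :
    ((weylMonomial (deltaD Q) (rhoD Q) p : Delta Q) : Module.End K (QuantumSpace Q)) =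
      weylMonomial (delta Q) (rho Q) p := by
  change (Delta Q).val (weylMonomial (deltaD Q) (rhoD Q) p) = _
  rw [weylMonomial_def, map_mul, map_ordMonomial, map_ordMonomial]
  rfl

theorem adjoin_eq_top :
    Algebra.adjoin K (Set.range (deltaD Q) ∪ Set.range (rhoD Q)) = ⊤ := by
  have h := Algebra.adjoin_adjoin_coe_preimage (R := K)
    (s := Set.range (rho Q) ∪ Set.range (delta Q))
  refine top_le_iff.1 (h.ge.trans (Algebra.adjoin_mono ?_))
  rintro ⟨g, hg⟩ (⟨i, hi⟩ | ⟨i, hi⟩)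
  · exact Or.inr ⟨i, Subtype.ext hi⟩
  · exact Or.inl ⟨i, Subtype.ext hi⟩

theorem linearIndependent_weylMonomial_delta [CharZero K] :
    LinearIndependent K (weylMonomial (deltaD Q) (rhoD Q)) := by
  refine LinearIndependent.of_comp (Delta Q).val.toLinearMap ?_
  have h : (Delta Q).val.toLinearMap ∘ weylMonomial (deltaD Q) (rhoD Q) =
      weylMonomial (delta Q) (rho Q) := funext (coe_weylMonomial Q)
  rw [h]
  exact linearIndependent_weylMonomial Q

/-- The basis of `Δ` formed by the monomials `ρ_I δ_J`. -/
noncomputable def deltaBasis [CharZero K] :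
    Module.Basis ((Fin n → ℕ) × (Fin n → ℕ)) K (Delta Q) :=
  Module.Basis.mk (linearIndependent_weylMonomial_delta Q)
    ((isWeylSystem_delta Q).span_weylMonomial (adjoin_eq_top Q)).ge

theorem deltaBasis_apply [CharZero K] (p : (Fin n → ℕ) × (Fin n → ℕ)) :
    deltaBasis Q p = weylMonomial (deltaD Q) (rhoD Q) p := by
  simp [deltaBasis]

end QuantumSpace

/-! ### The isomorphism with the quantized Weyl algebra -/

namespace QuantizedWeyl

variable {K : Type*} [Field K] {n : ℕ} (L : QuantumMatrix K n)

/-- Algebra maps out of `A_n^Λ`. -/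
def lift {A : Type*} [Ring A] [Algebra K A] {Q : QuantumMatrix K n} {u v : Fin n → A}
    (h : IsWeylSystem Q u v) : QuantizedWeyl Q.transpose →ₐ[K] A :=
  RingQuot.liftAlgHom K ⟨FreeAlgebra.lift K (Sum.elim u v), by
    intro a b hab
    cases hab with
    | vv i j => simpa [QuantumMatrix.transpose] using h.vv j i
    | uu i j => simpa [QuantumMatrix.transpose] using h.uu j i
    | uv i j hij => simpa [QuantumMatrix.transpose, hij] using h.uv j i
    | weyl i => simp [h.uv i i, Q.diag]⟩

theorem lift_mk {A : Type*} [Ring A] [Algebra K A] {Q : QuantumMatrix K n} {u v : Fin n → A}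
    (h : IsWeylSystem Q u v) (a : FreeAlgebra K (Fin n ⊕ Fin n)) :
    lift h (mk Q.transpose a) = FreeAlgebra.lift K (Sum.elim u v) a :=
  RingQuot.liftAlgHom_mkAlgHom_apply K _ _ _

theorem isWeylSystem (Q : QuantumMatrix K n) :
    IsWeylSystem Q (u Q.transpose) (v Q.transpose) where
  vv i j := by
    have h := RingQuot.mkAlgHom_rel K (QuantizedWeylRel.vv (L := Q.transpose) j i)
    rw [map_mul, map_smul, map_mul] at h
    exact h
  uu i j := by
    have h := RingQuot.mkAlgHom_rel K (QuantizedWeylRel.uu (L := Q.transpose) j i)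
    rw [map_mul, map_smul, map_mul] at h
    exact h
  uv i j := by
    rcases eq_or_ne j i with rfl | hij
    · have h := RingQuot.mkAlgHom_rel K (QuantizedWeylRel.weyl (L := Q.transpose) j)
      rw [map_sub, map_mul, map_mul, map_one, sub_eq_iff_eq_add'] at h
      rw [if_pos rfl, Q.diag, Units.val_one, one_smul]
      exact h
    · have h := RingQuot.mkAlgHom_rel K (QuantizedWeylRel.uv (L := Q.transpose) j i hij)
      rw [map_mul, map_smul, map_mul] at h
      rw [if_neg hij, add_zero]
      exact h

theorem adjoin_eq_top : Algebra.adjoin K (Set.range (u L) ∪ Set.range (v L)) = ⊤ := by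
  have hr : Set.range (u L) ∪ Set.range (v L) = mk L '' Set.range (FreeAlgebra.ι K) := by
    rw [← Set.range_comp, ← Set.Sum.elim_range]
    congr 1
    ext (i | i) <;> rfl
  rw [hr, ← AlgHom.map_adjoin, FreeAlgebra.adjoin_range_ι, Algebra.map_top,
    AlgHom.range_eq_top]
  exact RingQuot.mkAlgHom_surjective K _

/-- The sorted monomials of the presented algebra are only known to span, but their images form a
basis of `A`; this forces injectivity. -/
theorem lift_bijective {A : Type*} [Ring A] [Algebra K A] {Q : QuantumMatrix K n} {u v : Fin n → A}
    (h : IsWeylSystem Q u v) (hgen : Algebra.adjoin K (Set.range u ∪ Set.range v) = ⊤)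
    (hli : LinearIndependent K (weylMonomial u v)) : Function.Bijective (lift h) := by
  have hu : ∀ i, lift h (QuantizedWeyl.u Q.transpose i) = u i := fun i => by
    rw [QuantizedWeyl.u, lift_mk, FreeAlgebra.lift_ι_apply, Sum.elim_inl]
  have hv : ∀ i, lift h (QuantizedWeyl.v Q.transpose i) = v i := fun i => by
    rw [QuantizedWeyl.v, lift_mk, FreeAlgebra.lift_ι_apply, Sum.elim_inr]
  constructor
  · have hmon : (lift h).toLinearMap ∘
        weylMonomial (QuantizedWeyl.u Q.transpose) (QuantizedWeyl.v Q.transpose) =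
          weylMonomial u v := by
      ext1 p
      change lift h _ = _
      rw [weylMonomial_def, map_mul, map_ordMonomial, map_ordMonomial]
      simp only [hu, hv]
      rfl
    have hspan := (isWeylSystem Q).span_weylMonomial (adjoin_eq_top Q.transpose)
    let b := Module.Basis.mk hli (h.span_weylMonomial hgen).ge
    -- Sending the basis back to the abstract monomials gives a left inverse, as can be checked on
    -- the spanning monomials.
    let g := b.constr K (weylMonomial (QuantizedWeyl.u Q.transpose) (QuantizedWeyl.v Q.transpose))
    have hg : g ∘ₗ (lift h).toLinearMap = LinearMap.id := by
      refine LinearMap.ext_on_range hspan fun p => ?_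
      have hb : weylMonomial u v p = b p := by simp [b]
      rw [LinearMap.comp_apply, LinearMap.id_apply]
      change g (((lift h).toLinearMap ∘ weylMonomial _ _) p) = _
      rw [hmon, hb, Module.Basis.constr_basis]
    exact Function.LeftInverse.injective (g := g) (LinearMap.congr_fun hg)
  · rw [← AlgHom.range_eq_top, eq_top_iff, ← hgen, Algebra.adjoin_le_iff]
    rintro _ (⟨i, rfl⟩ | ⟨i, rfl⟩)
    · exact ⟨_, hu i⟩
    · exact ⟨_, hv i⟩

end QuantizedWeyl

/-! ### Right multiplication of quantum differential operators -/

section QuantumDiffOpMul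

variable {K R Γ : Type*} [Field K] [Ring R] [Algebra K R] [AddCommGroup Γ]
  {β : Γ → Γ → Kˣ} {𝒜 : Γ → Submodule K R}

theorem quantumStep_mono {M N : Submodule K (Module.End K R)} (h : M ≤ N) :
    quantumStep β 𝒜 M ≤ quantumStep β 𝒜 N := by
  refine Submodule.span_mono ?_
  rintro _ ⟨s, t, φ, he, ⟨a, ha⟩, rfl⟩
  exact ⟨s, t, φ, he, ⟨a, fun d r hr => h (ha d r hr)⟩, rfl⟩

theorem quantumDiffOpOfOrder_le_succ (m : ℕ) :
    quantumDiffOpOfOrder β 𝒜 m ≤ quantumDiffOpOfOrder β 𝒜 (m + 1) := by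
  induction m with
  | zero => exact quantumStep_mono bot_le
  | succ m ih => exact quantumStep_mono ih

theorem IsHomogeneousOfDegree.mul {φ ψ : Module.End K R} {e e' : Γ}
    (hφ : IsHomogeneousOfDegree 𝒜 φ e) (hψ : IsHomogeneousOfDegree 𝒜 ψ e') :
    IsHomogeneousOfDegree 𝒜 (φ * ψ) (e + e') := fun d r hr => by
  rw [add_assoc]
  exact hφ _ _ (hψ _ _ hr)

theorem one_mem_quantumDiffOpOfOrder (hβ : ∀ d, β 0 d = 1) :
    1 ∈ quantumDiffOpOfOrder β 𝒜 0 :=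
  Submodule.subset_span ⟨1, 1, 1, ⟨0, fun d r hr => by simpa using hr⟩,
    ⟨0, fun d r _ => by simp [hβ]⟩, by simp [← Module.End.one_eq_id]⟩

theorem mulLeft_mul_mem_quantumStep {N : Submodule K (Module.End K R)} (s : R)
    {ψ : Module.End K R} (hψ : ψ ∈ quantumStep β 𝒜 N) :
    LinearMap.mulLeft K s * ψ ∈ quantumStep β 𝒜 N := by
  refine (Submodule.span_le (p := (quantumStep β 𝒜 N).comap
    (LinearMap.mulLeft K (LinearMap.mulLeft K s)))).2 ?_ hψ
  rintro _ ⟨s', t, φ, he, ha, rfl⟩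
  refine Submodule.subset_span ⟨s * s', t, φ, he, ha, ?_⟩
  rw [LinearMap.mulLeft_apply, LinearMap.mulLeft_mul, ← mul_assoc, ← mul_assoc]
  rfl

theorem mul_mulLeft_mem_quantumStep {N : Submodule K (Module.End K R)} (t : R)
    {ψ : Module.End K R} (hψ : ψ ∈ quantumStep β 𝒜 N) :
    ψ * LinearMap.mulLeft K t ∈ quantumStep β 𝒜 N := by
  refine (Submodule.span_le (p := (quantumStep β 𝒜 N).comap
    (LinearMap.mulRight K (LinearMap.mulLeft K t)))).2 ?_ hψ
  rintro _ ⟨s, t', φ, he, ha, rfl⟩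
  refine Submodule.subset_span ⟨s, t' * t, φ, he, ha, ?_⟩
  rw [LinearMap.mulRight_apply, LinearMap.mulLeft_mul, mul_assoc]
  rfl

theorem mem_quantumStep {N : Submodule K (Module.End K R)} {φ : Module.End K R}
    (he : ∃ e, IsHomogeneousOfDegree 𝒜 φ e)
    (ha : ∃ a : Γ, ∀ d, ∀ r ∈ 𝒜 d,
      φ * LinearMap.mulLeft K r - (β a d : K) • (LinearMap.mulLeft K r * φ) ∈ N) :
    φ ∈ quantumStep β 𝒜 N :=
  Submodule.subset_span ⟨1, 1, φ, he, ha, by simp [← Module.End.one_eq_id]⟩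

/-- Right multiplication by a homogeneous operator `g` that skew-commutes with left multiplications
does not raise the order. -/
theorem mul_mem_quantumDiffOpOfOrder_of_skew (hβ : ∀ a b d, β (a + b) d = β a d * β b d)
    {g : Module.End K R} {e b : Γ} (hg : IsHomogeneousOfDegree 𝒜 g e)
    (hskew : ∀ d, ∀ r ∈ 𝒜 d,
      g * LinearMap.mulLeft K r = (β b d : K) • (LinearMap.mulLeft K r * g))
    (hright : ∀ t, ∃ t', LinearMap.mulLeft K t * g = g * LinearMap.mulLeft K t') (m : ℕ)
    {φ : Module.End K R} (hφ : φ ∈ quantumDiffOpOfOrder β 𝒜 m) :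
    φ * g ∈ quantumDiffOpOfOrder β 𝒜 m := by
  have step : ∀ N : Submodule K (Module.End K R), (∀ φ ∈ N, φ * g ∈ N) →
      ∀ φ ∈ quantumStep β 𝒜 N, φ * g ∈ quantumStep β 𝒜 N := by
    intro N hN φ hφ
    refine (Submodule.span_le (p := (quantumStep β 𝒜 N).comap (LinearMap.mulRight K g))).2 ?_ hφ
    rintro _ ⟨s, t, φ, ⟨e', he⟩, ⟨a, ha⟩, rfl⟩
    obtain ⟨t', ht'⟩ := hright t
    change LinearMap.mulLeft K s * φ * LinearMap.mulLeft K t * g ∈ quantumStep β 𝒜 N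
    rw [mul_assoc, ht', ← mul_assoc, mul_assoc _ φ g]
    -- The twists add: `φ` with twist `a` and `g` with twist `b` give `φ * g` with twist `a + b`.
    refine mul_mulLeft_mem_quantumStep _ (mulLeft_mul_mem_quantumStep _
      (mem_quantumStep ⟨_, he.mul hg⟩ ⟨a + b, fun d r hr => ?_⟩))
    have h : φ * g * LinearMap.mulLeft K r -
        (β (a + b) d : K) • (LinearMap.mulLeft K r * (φ * g)) = (β b d : K) •
          ((φ * LinearMap.mulLeft K r - (β a d : K) • (LinearMap.mulLeft K r * φ)) * g) := by
      rw [mul_assoc, hskew d r hr, mul_smul_comm, hβ, Units.val_mul, sub_mul, smul_sub,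
        smul_mul_assoc, smul_smul, mul_comm (β a d : K)]
      rfl
    rw [h]
    exact N.smul_mem _ (hN _ (ha d r hr))
  induction m generalizing φ with
  | zero =>
    refine step ⊥ (fun φ hφ => ?_) φ hφ
    rw [(Submodule.mem_bot K).1 hφ, zero_mul]
    exact zero_mem _
  | succ m ih => exact step _ (fun φ hφ => ih hφ) φ hφ

/-- Right multiplication by a homogeneous operator `g` that commutes with left multiplications
up to left multiplications times `σ` raises the order by at most one, if right multiplication by
`σ` does not raise it. -/
theorem mul_mem_quantumDiffOpOfOrder_succ {g σ : Module.End K R} {e : Γ}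
    (hg : IsHomogeneousOfDegree 𝒜 g e)
    (hσ : ∀ m, ∀ φ ∈ quantumDiffOpOfOrder β 𝒜 m, φ * σ ∈ quantumDiffOpOfOrder β 𝒜 m)
    (hcomm : ∀ r, ∃ r', g * LinearMap.mulLeft K r =
      LinearMap.mulLeft K r * g + LinearMap.mulLeft K r' * σ) (m : ℕ)
    {φ : Module.End K R} (hφ : φ ∈ quantumDiffOpOfOrder β 𝒜 m) :
    φ * g ∈ quantumDiffOpOfOrder β 𝒜 (m + 1) := by
  have step : ∀ N : Submodule K (Module.End K R),
      (∀ φ ∈ quantumStep β 𝒜 N, φ * σ ∈ quantumStep β 𝒜 N) → N ≤ quantumStep β 𝒜 N →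
      (∀ φ ∈ N, φ * g ∈ quantumStep β 𝒜 N) →
      ∀ φ ∈ quantumStep β 𝒜 N, φ * g ∈ quantumStep β 𝒜 (quantumStep β 𝒜 N) := by
    intro N hNσ hle hN φ hφ
    refine (Submodule.span_le (p := (quantumStep β 𝒜 (quantumStep β 𝒜 N)).comap
      (LinearMap.mulRight K g))).2 ?_ hφ
    rintro _ ⟨s, t, φ, he, ha, rfl⟩
    have hφN : φ ∈ quantumStep β 𝒜 N := mem_quantumStep he ha
    obtain ⟨t', ht'⟩ := hcomm t
    obtain ⟨e', he⟩ := he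
    obtain ⟨a, ha⟩ := ha
    change LinearMap.mulLeft K s * φ * LinearMap.mulLeft K t * g ∈
      quantumStep β 𝒜 (quantumStep β 𝒜 N)
    -- Moving `g` leftwards past the multiplication by `t` leaves a term in `σ`, which has no higher
    -- order than `φ`.
    rw [mul_assoc, eq_sub_of_add_eq ht'.symm, mul_sub, ← mul_assoc, ← mul_assoc, mul_assoc _ φ g]
    refine sub_mem (mul_mulLeft_mem_quantumStep _ (mulLeft_mul_mem_quantumStep _
      (mem_quantumStep ⟨_, IsHomogeneousOfDegree.mul he hg⟩ ⟨a, fun d r hr => ?_⟩)))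
      (quantumStep_mono hle (hNσ _ (mul_mulLeft_mem_quantumStep _
        (mulLeft_mul_mem_quantumStep _ hφN))))
    obtain ⟨r', hr'⟩ := hcomm r
    have h : φ * g * LinearMap.mulLeft K r - (β a d : K) • (LinearMap.mulLeft K r * (φ * g)) =
        (φ * LinearMap.mulLeft K r - (β a d : K) • (LinearMap.mulLeft K r * φ)) * g +
          φ * LinearMap.mulLeft K r' * σ := by
      rw [mul_assoc, hr', mul_add, sub_mul, smul_mul_assoc, mul_assoc, mul_assoc, mul_assoc]
      abel
    rw [h]
    exact add_mem (hN _ (ha d r hr)) (hNσ _ (mul_mulLeft_mem_quantumStep _ hφN))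
  induction m generalizing φ with
  | zero =>
    refine step ⊥ (hσ 0) bot_le (fun φ hφ => ?_) φ hφ
    rw [(Submodule.mem_bot K).1 hφ, zero_mul]
    exact zero_mem _
  | succ m ih =>
    exact step _ (hσ (m + 1)) (quantumDiffOpOfOrder_le_succ m) (fun φ hφ => ih hφ) φ hφ

end QuantumDiffOpMul

/-! ### The inclusion of `Δ` in the quantum differential operators. -/

namespace QuantumSpace

variable {K : Type*} [Field K] {n : ℕ} (Q : QuantumMatrix K n)

theorem bichar_add_left (a b d : Fin n → ℤ) :
    bichar Q (a + b) d = bichar Q a d * bichar Q b d := by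
  simp [bichar, add_mul, zpow_add, Finset.prod_mul_distrib]

theorem bichar_add_right (a d e : Fin n → ℤ) :
    bichar Q a (d + e) = bichar Q a d * bichar Q a e := by
  simp [bichar, mul_add, zpow_add, Finset.prod_mul_distrib]

theorem bichar_zero_left (d : Fin n → ℤ) : bichar Q 0 d = 1 := by
  simp [bichar]

theorem bichar_zero_right (a : Fin n → ℤ) : bichar Q a 0 = 1 := by
  simp [bichar]

theorem wordDegree_cons (j : Fin n) (w : List (Fin n)) :
    wordDegree (j :: w) = Pi.single j 1 + wordDegree w := by
  simp [wordDegree]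

theorem word_mem_grading (w : List (Fin n)) :
    (w.map (x Q)).prod ∈ grading Q (wordDegree w) :=
  Submodule.subset_span ⟨w, rfl, rfl⟩

theorem sigma_apply_of_mem {a d : Fin n → ℤ} {r : QuantumSpace Q} (hr : r ∈ grading Q d) :
    sigma Q a r = (bichar Q a d : K) • r := by
  induction hr using Submodule.span_induction with
  | mem r h =>
    obtain ⟨w, rfl, rfl⟩ := h
    induction w with
    | nil => simp [wordDegree, bichar_zero_right]
    | cons j w ih =>
      rw [List.map_cons, List.prod_cons, map_mul, ih, sigma_x, wordDegree_cons, bichar_add_right,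
        smul_mul_smul_comm, Units.val_mul]
  | zero => simp
  | add r s _ _ hr hs => rw [map_add, hr, hs, smul_add]
  | smul c r _ hr => rw [map_smul, hr, smul_comm]

theorem sigma_sigma_neg (a : Fin n → ℤ) (r : QuantumSpace Q) :
    sigma Q a (sigma Q (-a) r) = r := by
  have h : (sigma Q a).comp (sigma Q (-a)) = AlgHom.id K _ := by
    apply hom_ext
    intro j
    rw [AlgHom.comp_apply, sigma_x, map_smul, sigma_x, smul_smul, ← Units.val_mul,
      ← bichar_add_left, neg_add_cancel, bichar_zero_left, Units.val_one, one_smul]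
    rfl
  exact DFunLike.congr_fun h r

theorem isHomogeneousOfDegree_delta (i : Fin n) :
    IsHomogeneousOfDegree (grading Q) (delta Q i) (-Pi.single i 1) := by
  intro d r hr
  induction hr using Submodule.span_induction with
  | mem r h =>
    obtain ⟨w, rfl, rfl⟩ := h
    induction w with
    | nil =>
      rw [List.map_nil, List.prod_nil, delta_one]
      exact zero_mem _
    | cons j w ih =>
      rw [List.map_cons, List.prod_cons, delta_mul, delta_x, wordDegree_cons]
      refine add_mem ?_ ?_
      · split_ifs with hj
        · rw [hj, neg_add_cancel_left, one_mul, sigma_apply_of_mem Q (word_mem_grading Q w)]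
          exact Submodule.smul_mem _ _ (word_mem_grading Q w)
        · rw [zero_mul]
          exact zero_mem _
      · rw [add_left_comm]
        exact SetLike.mul_mem_graded (x_mem_grading Q j) ih
  | zero => rw [map_zero]; exact zero_mem _
  | add r s _ _ hr hs => rw [map_add]; exact add_mem hr hs
  | smul c r _ hr => rw [map_smul]; exact Submodule.smul_mem _ _ hr

theorem mul_rho_mem (i : Fin n) (m : ℕ) {φ : Module.End K (QuantumSpace Q)}
    (hφ : φ ∈ quantumDiffOpOfOrder (bichar Q) (grading Q) m) :
    φ * rho Q i ∈ quantumDiffOpOfOrder (bichar Q) (grading Q) m := by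
  have hcomm : ∀ r : QuantumSpace Q,
      rho Q i * LinearMap.mulLeft K r = LinearMap.mulLeft K r * rho Q i := fun r => by
    ext s
    simp [rho, mul_assoc]
  refine mul_mem_quantumDiffOpOfOrder_of_skew (bichar_add_left Q) (e := Pi.single i 1) (b := 0)
    (fun d r hr => ?_) (fun d r _ => ?_) (fun t => ⟨t, (hcomm t).symm⟩) m hφ
  · rw [add_comm]
    exact SetLike.mul_mem_graded hr (x_mem_grading Q i)
  · rw [bichar_zero_left, Units.val_one, one_smul, hcomm]

/-- Being an algebra map that is scalar on each degree, `σ_a` skew-commutes with homogeneous left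
multiplications; its inverse `σ_{-a}` moves it past arbitrary ones. -/
theorem mul_sigma_mem (a : Fin n → ℤ) (m : ℕ) {φ : Module.End K (QuantumSpace Q)}
    (hφ : φ ∈ quantumDiffOpOfOrder (bichar Q) (grading Q) m) :
    φ * (sigma Q a).toLinearMap ∈ quantumDiffOpOfOrder (bichar Q) (grading Q) m := by
  refine mul_mem_quantumDiffOpOfOrder_of_skew (bichar_add_left Q) (e := 0) (b := a)
    (fun d r hr => ?_) (fun d r hr => ?_) (fun t => ⟨sigma Q (-a) t, ?_⟩) m hφ
  · rw [zero_add, AlgHom.toLinearMap_apply, sigma_apply_of_mem Q hr]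
    exact Submodule.smul_mem _ _ hr
  · ext s
    simp [sigma_apply_of_mem Q hr]
  · ext s
    simp [sigma_sigma_neg]

/-- The twisted Leibniz rule says that `δ_i` commutes with left multiplication by `r` up to left
multiplication by `δ_i r` times `σ_{e_i}`. -/
theorem mul_delta_mem (i : Fin n) (m : ℕ) {φ : Module.End K (QuantumSpace Q)}
    (hφ : φ ∈ quantumDiffOpOfOrder (bichar Q) (grading Q) m) :
    φ * delta Q i ∈ quantumDiffOpOfOrder (bichar Q) (grading Q) (m + 1) := by
  refine mul_mem_quantumDiffOpOfOrder_succ (isHomogeneousOfDegree_delta Q i)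
    (fun m φ hφ => mul_sigma_mem Q (Pi.single i 1) m hφ) (fun r => ⟨delta Q i r, ?_⟩) m hφ
  ext s
  simp [delta_mul, add_comm]

/-- It is enough that `D_q(R)` contains `1` and is stable under right multiplication by the
generators of `Δ`; closure of `D_q(R)` under all products is not needed. -/
theorem delta_le_quantumDiffOp :
    Subalgebra.toSubmodule (Delta Q) ≤ quantumDiffOp (bichar Q) (grading Q) := by
  have key : ∀ g ∈ Delta Q, ∀ φ ∈ quantumDiffOp (bichar Q) (grading Q),
      φ * g ∈ quantumDiffOp (bichar Q) (grading Q) := by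
    intro g hg
    induction hg using Algebra.adjoin_induction with
    | mem g hg =>
      change quantumDiffOp _ _ ≤ (quantumDiffOp _ _).comap (LinearMap.mulRight K g)
      refine iSup_le fun m φ hφ => ?_
      rcases hg with ⟨i, rfl⟩ | ⟨i, rfl⟩
      · exact Submodule.mem_iSup_of_mem m (mul_rho_mem Q i m hφ)
      · exact Submodule.mem_iSup_of_mem (m + 1) (mul_delta_mem Q i m hφ)
    | algebraMap c =>
      intro φ hφ
      rw [← Algebra.commutes, ← Algebra.smul_def]
      exact Submodule.smul_mem _ _ hφ
    | add g g' _ _ hg hg' =>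
      intro φ hφ
      rw [mul_add]
      exact add_mem (hg φ hφ) (hg' φ hφ)
    | mul g g' _ _ hg hg' =>
      intro φ hφ
      rw [← mul_assoc]
      exact hg' _ (hg φ hφ)
  intro g hg
  rw [← one_mul g]
  exact key g hg 1 (Submodule.mem_iSup_of_mem 0
    (one_mem_quantumDiffOpOfOrder (bichar_zero_left Q)))

end QuantumSpace

theorem mainTheorem8 {K : Type*} [Field K] [CharZero K] (n : ℕ) (hn : 3 ≤ n)
    (Q : QuantumMatrix K n)
    (hQ : AlgebraicIndependent ℚ
      (fun p : {p : Fin n × Fin n // p.1 < p.2} => (Q.entry p.1.1 p.1.2 : K))) :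
    Subalgebra.toSubmodule (QuantumSpace.Delta Q) ≤
        quantumDiffOp (QuantumSpace.bichar Q) (QuantumSpace.grading Q) ∧
      IsSimpleRing (QuantumSpace.Delta Q) ∧
      IsNoetherianRing (QuantumSpace.Delta Q) ∧
      IsNoetherianRing (QuantumSpace.Delta Q)ᵐᵒᵖ ∧
      IsDomain (QuantumSpace.Delta Q) ∧
      gkDim K (QuantumSpace.Delta Q) = ((2 * n : ℕ) : EReal) ∧
      (∃ b : Module.Basis ((Fin n → ℕ) × (Fin n → ℕ)) K (QuantumSpace.Delta Q),
        ∀ I J, (b (I, J) : Module.End K (QuantumSpace Q)) =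
          QuantumSpace.rhoMonomial Q I * QuantumSpace.deltaMonomial Q J) ∧
      (∃ θ : QuantizedWeyl Q.transpose ≃ₐ[K] QuantumSpace.Delta Q,
        (∀ i, (θ (QuantizedWeyl.u Q.transpose i) : Module.End K (QuantumSpace Q)) =
          QuantumSpace.delta Q i) ∧
        ∀ i, (θ (QuantizedWeyl.v Q.transpose i) : Module.End K (QuantumSpace Q)) =
          QuantumSpace.rho Q i) := by
  have hW := QuantumSpace.isWeylSystem_delta Q
  have hb := QuantumSpace.deltaBasis_apply Q
  have hli := QuantumSpace.linearIndependent_weylMonomial_delta Q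
  have hgen := QuantumSpace.adjoin_eq_top Q
  refine ⟨QuantumSpace.delta_le_quantumDiffOp Q, hW.isSimpleRing hb, hW.isNoetherianRing hb,
    hW.isNoetherianRing_op hb, hW.isDomain hb, hW.gkDim_eq hli (hW.span_weylMonomial hgen),
    ⟨QuantumSpace.deltaBasis Q, fun I J => ?_⟩,
    AlgEquiv.ofBijective (QuantizedWeyl.lift hW) (QuantizedWeyl.lift_bijective hW hgen hli),
    fun i => ?_, fun i => ?_⟩
  · rw [hb, QuantumSpace.coe_weylMonomial]
    rfl
  · rw [AlgEquiv.ofBijective_apply, QuantizedWeyl.u, QuantizedWeyl.lift_mk,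
      FreeAlgebra.lift_ι_apply]
    rfl
  · rw [AlgEquiv.ofBijective_apply, QuantizedWeyl.v, QuantizedWeyl.lift_mk,
      FreeAlgebra.lift_ι_apply]
    rfl
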